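/- **Setting.** Let $\hat a,\hat b,\hat c,\hat d,\hat e,\hat f\in\mathbb C$ with $\hat a\hat c\ne0$, $\lambda=\hat b^2-\hat a\hat c\neq0$ and $\tau=\big((\hat b^2-\hat a\hat c)(\hat d^2-\hat a\hat f)-(\hat b\hat d-\hat a\hat e)^2\big)/\hat a\ne0$. Let $y_1,y_2\in\mathbb C((1/x))$ be the two roots in $y$ of $\hat a y^2+2\hat bxy+\hat cx^2+2\hat dy+2\hat ex+\hat f=0$, and put $\Delta_y=y_2-y_1$. For a formal Laurent series $f\in\mathbb C((1/x))$ put $$\mathbb E_jf=f(y_j),\qquad \mathbb Df=\frac{\mathbb E_2f-\mathbb E_1f}{y_2-y_1},\qquad \mathbb Mf=\frac{\mathbb E_1f+\mathbb E_2f}{2}.$$ Let $S=\sum_{n\ge0}u_nx^{-n-1}$ with $u_0=1$ and $\det[u_{i+j}]_{i,j=0}^n\neq0$ for all $n\ge0$. Let $P_n$ (monic of degree $n$) and $P^{(1)}_{n-1}$ (of degree less than $n$) be the polynomials with $S-P^{(1)}_{n-1}/P_n=O(x^{-2n-1})$, $n\ge0$, with $P_{-1}=P^{(1)}_{-1}=0$.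 Let $q_n=P_nS-P^{(1)}_{n-1}$ for $n\ge0$ (so $q_0=S$) and $q_{-1}=1$. Suppose that, for polynomials $A,B,C,D\in\mathbb C[x]$, $$A\,\mathbb DS=B\,\mathbb E_1S\,\mathbb E_2S+C\,\mathbb MS+D .$$ **Claim.** (i) There are $\beta_n,\gamma_n\in\mathbb C$ ($n\ge 0$), $\gamma_n\ne0$, $\gamma_0=1$, with $P_{n+1}=(x-\beta_n)P_n-\gamma_nP_{n-1}$ for $n\ge0$ and $P^{(1)}_{n}=(x-\beta_n)P^{(1)}_{n-1}-\gamma_nP^{(1)}_{n-2}$ for $n\ge1$. (ii) There are polynomials $l_n,\pi_n,\Theta_n$, $n\ge-1$, of uniformly bounded degrees, with $\pi_{-1}=0$, $l_{-1}=C/2$, $\Theta_{-1}=D$, such that for all $n\ge1$ $$\begin{aligned} A\,\mathbb DP_n&=(l_{n-1}+\Delta_y\pi_{n-1})\mathbb E_1P_n-\tfrac C2\mathbb E_2P_n-B\,\mathbb E_2P^{(1)}_{n-1}+\Theta_{n-1}\mathbb E_1P_{n-1},\\ A\,\mathbb DP^{(1)}_{n-1}&=(l_{n-1}+\Delta_y\pi_{n-1})\mathbb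 E_1P^{(1)}_{n-1}+\tfrac C2\mathbb E_2P^{(1)}_{n-1}+D\,\mathbb E_2P_{n}+\Theta_{n-1}\mathbb E_1P^{(1)}_{n-2}, \end{aligned}\tag{1}$$ and for all $n\ge0$ $$A\,\mathbb Dq_n=(l_{n-1}+\Delta_y\pi_{n-1})\mathbb E_1q_n+\big(B\,\mathbb E_1S+\tfrac C2\big)\mathbb E_2q_n+\Theta_{n-1}\mathbb E_1q_{n-1}.$$ (iii) Let $\beta_n,\gamma_n$ be as in (i), and let $l_n,\pi_n,\Theta_n$ ($n\ge-1$) be any polynomials that satisfy (1) for all $n\ge1$ and take the values $\pi_{-1}=0$, $l_{-1}=C/2$, $\Theta_{-1}=D$ at the index $-1$. Then for all $n\ge0$ $$\pi_{n+1}+\pi_n=-\frac{\Theta_n}{2\gamma_{n+1}}-\sum_{k=0}^n\frac{\Theta_{k-1}}{\gamma_k},$$ $$l_{n+1}+l_n+\mathbb M(x-\beta_{n+1})\frac{\Theta_n}{\gamma_{n+1}}=0,$$ $$\begin{aligned}\Theta_{n+1}={}&A+\frac{\Delta_y^2}{2}(\pi_n+\pi_{n-1})+\frac{\Theta_{n-1}}{\gamma_n}\Big(-\frac{\Delta_y^2}{4}+\gamma_{n+1}-\mathbb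 M(x-\beta_n)\,\mathbb M(x-\beta_{n+1})\Big)\\&+\frac{\Theta_n}{\gamma_{n+1}}\mathbb E_1(x-\beta_{n+1})\,\mathbb E_2(x-\beta_{n+1})+\mathbb M(x-\beta_{n+1})(l_n-l_{n-1}),\end{aligned}$$ and moreover $$\pi_0=-\frac D2,\qquad l_0=-\mathbb M(x-\beta_0)\,D-\frac C2,\qquad \Theta_0=A-\frac{\Delta_y^2}{4}D-\Big(l_0-\frac C2\Big)\mathbb M(x-\beta_0)+B .$$ -/

import Mathlib

open Polynomial

noncomputable section

namespace LaguerreHahn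

/-- Formal Laurent series at infinity, `ℂ((1/x))`: the coefficient of index `k` is the coefficient
of `x ^ (-k)`, so that `HahnSeries.single 1 1` is `1 / x`. -/
abbrev LaurentAtInf : Type := LaurentSeries ℂ

/-- The variable `x` as a Laurent series at infinity. -/
def xInf : LaurentAtInf := HahnSeries.single (-1 : ℤ) (1 : ℂ)

/-- A polynomial in `x`, read as a Laurent series at infinity. -/
def ofPoly : ℂ[X] →ₐ[ℂ] LaurentAtInf := Polynomial.aeval xInf

/-- Composition `f ↦ f(y)` for a Laurent series `y` with a pole at infinity. Writing
`f = ∑ k ≥ m, f_k x ^ (-k)` with `m` the order of `f`, this is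
`y ^ (-m) * ∑ j ≥ 0, f_{m+j} (1/y) ^ j`. The sum converges formally because `1/y` has positive
order. -/
def comp (y f : LaurentAtInf) : LaurentAtInf :=
  y ^ (-f.order) * PowerSeries.heval y⁻¹ f.powerSeriesPart

/-- `f = O(x ^ (-m))` as `x → ∞`. -/
def IsBigOInf (f : LaurentAtInf) (m : ℤ) : Prop := ∀ k : ℤ, k < m → f.coeff k = 0

/-- The conic `a y² + 2 b x y + c x² + 2 d y + 2 e x + f = 0`, with `a c ≠ 0`, in the general
(`q`-quadratic) case `λ τ ≠ 0`. -/
structure Conic where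
  (a b c d e f : ℂ)
  a_ne : a ≠ 0
  c_ne : c ≠ 0
  lambda_ne : b ^ 2 - a * c ≠ 0
  tau_ne :
    ((b ^ 2 - a * c) * (d ^ 2 - a * f) - (b * d - a * e) ^ 2) / a ≠ 0

/-- `y₁, y₂` are the two roots, in `y`, of the quadratic equation given by the conic. -/
def Conic.IsRoots (K : Conic) (y₁ y₂ : LaurentAtInf) : Prop :=
  y₁ + y₂ = ofPoly (C (-2 / K.a) * (C K.b * X + C K.d)) ∧
  y₁ * y₂ = ofPoly (C (1 / K.a) * (C K.c * X ^ 2 + C (2 * K.e) * X + C K.f))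

/-- The divided difference operator `𝔻 f = (f(y₂) - f(y₁)) / (y₂ - y₁)`. -/
def divDiff (y₁ y₂ f : LaurentAtInf) : LaurentAtInf :=
  (comp y₂ f - comp y₁ f) / (y₂ - y₁)

/-- The companion operator `𝕄 f = (f(y₁) + f(y₂)) / 2`. -/
def mean (y₁ y₂ f : LaurentAtInf) : LaurentAtInf :=
  (comp y₁ f + comp y₂ f) / 2

/-- Regular normalized moment sequences: `u₀ = 1` and all Hankel determinants are nonzero. -/
def IsRegular (u : ℕ → ℂ) : Prop :=
  u 0 = 1 ∧ ∀ n : ℕ, (Matrix.of fun i j : Fin (n + 1) => u ((i : ℕ) + (j : ℕ))).det ≠ 0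

/-- The formal Stieltjes function `∑ n ≥ 0, u_n x ^ (-n-1)`. -/
def stieltjes (u : ℕ → ℂ) : LaurentAtInf :=
  HahnSeries.ofPowerSeries ℤ ℂ (PowerSeries.X * PowerSeries.mk u)

/-- `P n` (`n ≥ -1`) is the sequence of monic orthogonal polynomials related to `S` and `P1 n`
(`n ≥ -1`) is the sequence of associated polynomials of the first kind: `P n` and `P1 (n - 1)` are
the denominator and the numerator of the diagonal Padé approximants of `S`. Here
`P (-1) = P1 (-1) = 0`; indices below `-1` play no role. -/
structure IsSMOP (S : LaurentAtInf) (P P1 : ℤ → ℂ[X]) : Prop where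
  P_neg_one : P (-1) = 0
  P1_neg_one : P1 (-1) = 0
  monic : ∀ n : ℕ, (P n).Monic
  natDegree_eq : ∀ n : ℕ, (P n).natDegree = n
  degree_lt : ∀ n : ℕ, (P1 ((n : ℤ) - 1)).degree < n
  pade : ∀ n : ℕ,
    IsBigOInf (S - ofPoly (P1 ((n : ℤ) - 1)) / ofPoly (P n)) (2 * n + 1)

/-- `β`, `γ` are the coefficients of the three-term recurrence relations of `P` and `P1`, with the
convention `γ 0 = 1`. -/
structure IsRecurrenceCoeffs (P P1 : ℤ → ℂ[X]) (β γ : ℕ → ℂ) : Prop where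
  gamma_zero : γ 0 = 1
  gamma_ne : ∀ n : ℕ, γ n ≠ 0
  rec_P : ∀ n : ℕ, P (n + 1) = (X - C (β n)) * P n - C (γ n) * P ((n : ℤ) - 1)
  rec_P1 : ∀ n : ℕ, 1 ≤ n →
    P1 n = (X - C (β n)) * P1 ((n : ℤ) - 1) - C (γ n) * P1 ((n : ℤ) - 2)

/-- The functions of the second kind: `q_n = P_n S - P1_{n-1}` for `n ≥ 0`, and `q_{-1} = 1`. -/
def secondKind (S : LaurentAtInf) (P P1 : ℤ → ℂ[X]) (n : ℤ) : LaurentAtInf :=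
  if n < 0 then 1 else ofPoly (P n) * S - ofPoly (P1 (n - 1))

/-- The Riccati equation `A 𝔻S = B 𝔼₁S 𝔼₂S + C 𝕄S + D`. -/
def Riccati (y₁ y₂ S : LaurentAtInf) (A B C D : ℂ[X]) : Prop :=
  ofPoly A * divDiff y₁ y₂ S =
    ofPoly B * (comp y₁ S * comp y₂ S) + ofPoly C * mean y₁ y₂ S + ofPoly D

/-- The structure relations of `P_n` and `P1_{n-1}`, for all `n ≥ 1`, with coefficients
`l_{n-1}, π_{n-1}, Θ_{n-1}`. -/
def StructureRelations (y₁ y₂ : LaurentAtInf) (A B C D : ℂ[X]) (P P1 l π Θ : ℤ → ℂ[X]) : Prop :=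
  ∀ n : ℕ, 1 ≤ n →
    ofPoly A * divDiff y₁ y₂ (ofPoly (P n)) =
      (ofPoly (l ((n : ℤ) - 1)) + (y₂ - y₁) * ofPoly (π ((n : ℤ) - 1))) * comp y₁ (ofPoly (P n))
        - ofPoly C / 2 * comp y₂ (ofPoly (P n))
        - ofPoly B * comp y₂ (ofPoly (P1 ((n : ℤ) - 1)))
        + ofPoly (Θ ((n : ℤ) - 1)) * comp y₁ (ofPoly (P ((n : ℤ) - 1))) ∧
    ofPoly A * divDiff y₁ y₂ (ofPoly (P1 ((n : ℤ) - 1))) =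
      (ofPoly (l ((n : ℤ) - 1)) + (y₂ - y₁) * ofPoly (π ((n : ℤ) - 1)))
          * comp y₁ (ofPoly (P1 ((n : ℤ) - 1)))
        + ofPoly C / 2 * comp y₂ (ofPoly (P1 ((n : ℤ) - 1)))
        + ofPoly D * comp y₂ (ofPoly (P n))
        + ofPoly (Θ ((n : ℤ) - 1)) * comp y₁ (ofPoly (P1 ((n : ℤ) - 2)))

/-- The structure relations of the functions of the second kind `q_n`, for all `n ≥ 0`, with
coefficients `l_{n-1}, π_{n-1}, Θ_{n-1}`. -/
def SecondKindRelations (y₁ y₂ S : LaurentAtInf) (A B C : ℂ[X]) (P P1 l π Θ : ℤ → ℂ[X]) : Prop :=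
  ∀ n : ℕ,
    ofPoly A * divDiff y₁ y₂ (secondKind S P P1 n) =
      (ofPoly (l ((n : ℤ) - 1)) + (y₂ - y₁) * ofPoly (π ((n : ℤ) - 1)))
          * comp y₁ (secondKind S P P1 n)
        + (ofPoly B * comp y₁ S + ofPoly C / 2) * comp y₂ (secondKind S P P1 n)
        + ofPoly (Θ ((n : ℤ) - 1)) * comp y₁ (secondKind S P P1 ((n : ℤ) - 1))

/-- The values of `l, π, Θ` at the index `-1`. With these values the relation for `q_0 = S` is the
Riccati equation of `S`. -/
def InitialValues (C D : ℂ[X]) (l π Θ : ℤ → ℂ[X]) : Prop :=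
  π (-1) = 0 ∧ l (-1) = Polynomial.C (1 / 2) * C ∧ Θ (-1) = D

/-- The members of index `n ≥ -1` of a sequence of polynomials have uniformly bounded degrees. -/
def BoundedDegrees (f : ℤ → ℂ[X]) : Prop := ∃ N : ℕ, ∀ n : ℤ, -1 ≤ n → (f n).natDegree ≤ N

/-- `x - β` as a Laurent series at infinity. -/
def xSub (β : ℂ) : LaurentAtInf := ofPoly (X - C β)

end LaguerreHahn

end

/-!
Since `λ ≠ 0` and `a c ≠ 0`, both roots `y₁, y₂` have a simple pole at infinity, so that
`f ↦ f(y_j)` is a ring homomorphism that preserves orders at infinity (`compHom`, `IsBigOInf.comp`).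
Since `τ ≠ 0`, the polynomial `Δ² = (y₂ - y₁)²` has a simple root and is not a square, so that `1`
and `Δ` are linearly independent over `ℂ[x]` (`Conic.IsRoots.quadraticPair`). Every identity in
`ℂ[x] ⊕ Δ ℂ[x]` therefore splits into an even and an odd part under the exchange of `y₁` and `y₂`.

It is convenient to start the columns `(P_n, P1_{n-1})` with `(0, -1)` at the index `-1`. With this
value the recurrence relation, the structure relation, and the formula `q_n = P_n S - P1_{n-1}` hold
from the first index on.

*Recurrence relation.* By the nonvanishing of the Hankel determinants, a polynomial of degree less
than `n` whose product with `S` agrees with a polynomial up to `O(x^{-n-1})` is zero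
(`IsRegular.eq_zero`). This shows that the leading coefficients of the `q_n` do not vanish, and it
applies to the defect of the recurrence relation (`IsSMOP.exists_rec`).

*Structure relations.* The two relations of index `n` are a linear system for `l + Δ π` and `Θ`,
whose determinant is the Wronskian of `P` and `P1`, a nonzero constant
(`ShiftRec.exists_wronskian`). By Cramer's rule the solution lies in `ℂ[x] ⊕ Δ ℂ[x]`, and `Θ` is
symmetric in `y₁, y₂`, hence in `ℂ[x]` (`QuadraticPair.exists_structureRel`). Substituting
`P1_{n-1} = P_n S - q_n` in the numerators, the terms that grow with `n` cancel by the Riccati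
equation. What is left is bounded by products of `P_n` and `q_n`, which gives the bound on the
degrees (`isBigOInf_cramer`).

*Recurrences for the coefficients.* The product rule for the divided difference turns the recurrence
relation into a relation between the structure relations of three consecutive indices. Comparing the
coefficients of two linearly independent columns (`QuadraticPair.compatibility`), then even and odd
parts (`QuadraticPair.compatibility_split`), gives second-order recurrences for `l` and `π`, which
telescope, and an expression for `Θ` (`QuadraticPair.coefficient_recurrences`).
-/

namespace LaguerreHahn

/-! ### Laurent series at infinity and composition -/

theorem isBigOInf_iff {f : LaurentAtInf} {m : ℤ} :
    IsBigOInf f m ↔ (m : WithTop ℤ) ≤ f.orderTop := by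
  simp [HahnSeries.le_orderTop_iff_forall, IsBigOInf]

theorem IsBigOInf.mono {f : LaurentAtInf} {m n : ℤ} (hf : IsBigOInf f m) (h : n ≤ m) :
    IsBigOInf f n := fun k hk => hf k (hk.trans_le h)

theorem IsBigOInf.add {f g : LaurentAtInf} {m : ℤ} (hf : IsBigOInf f m) (hg : IsBigOInf g m) :
    IsBigOInf (f + g) m := fun k hk => by simp [hf k hk, hg k hk]

theorem IsBigOInf.neg {f : LaurentAtInf} {m : ℤ} (hf : IsBigOInf f m) :
    IsBigOInf (-f) m := fun k hk => by simp [hf k hk]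

theorem IsBigOInf.sub {f g : LaurentAtInf} {m : ℤ} (hf : IsBigOInf f m) (hg : IsBigOInf g m) :
    IsBigOInf (f - g) m := fun k hk => by simp [hf k hk, hg k hk]

theorem IsBigOInf.mul {f g : LaurentAtInf} {m n : ℤ} (hf : IsBigOInf f m) (hg : IsBigOInf g n) :
    IsBigOInf (f * g) (m + n) := by
  rw [isBigOInf_iff] at *
  rw [HahnSeries.orderTop_mul]
  push_cast
  exact add_le_add hf hg

theorem algebraMap_eq_single (a : ℂ) : algebraMap ℂ LaurentAtInf a = HahnSeries.single 0 a := by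
  rw [HahnSeries.algebraMap_apply', PowerSeries.algebraMap_apply, HahnSeries.ofPowerSeries_C,
    HahnSeries.C_apply]
  rfl

theorem ofPoly_monomial (n : ℕ) (a : ℂ) :
    ofPoly (monomial n a) = HahnSeries.single (-n : ℤ) a := by
  rw [ofPoly, aeval_monomial, xInf, HahnSeries.single_pow, algebraMap_eq_single,
    HahnSeries.single_mul_single]
  simp

theorem coeff_ofPoly (p : ℂ[X]) (k : ℤ) :
    (ofPoly p).coeff k = if k ≤ 0 then p.coeff (-k).toNat else 0 := by
  induction p using Polynomial.induction_on' with
  | add p q hp hq =>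
    simp only [map_add, HahnSeries.coeff_add, hp, hq, coeff_add]
    split_ifs <;> simp
  | monomial n a =>
    rw [ofPoly_monomial, HahnSeries.coeff_single, coeff_monomial]
    split_ifs <;> first | rfl | omega

theorem ofPoly_injective : Function.Injective ofPoly := by
  intro p q h
  ext n
  have := congrArg (fun f => f.coeff (-n : ℤ)) h
  simpa [coeff_ofPoly] using this

theorem isBigOInf_ofPoly {p : ℂ[X]} {m : ℕ} (h : p.natDegree ≤ m) : IsBigOInf (ofPoly p) (-m) := by
  intro k hk
  rw [coeff_ofPoly, if_pos (by omega), coeff_eq_zero_of_natDegree_lt (by omega)]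

theorem natDegree_le_of_isBigOInf {p : ℂ[X]} {m : ℕ} (h : IsBigOInf (ofPoly p) (-m)) :
    p.natDegree ≤ m := by
  rw [natDegree_le_iff_coeff_eq_zero]
  intro n hn
  simpa [coeff_ofPoly] using h (-n) (by omega)

theorem eq_zero_of_isBigOInf_one {p : ℂ[X]} (h : IsBigOInf (ofPoly p) 1) : p = 0 := by
  ext n
  simpa [coeff_ofPoly] using h (-n) (by omega)

theorem isBigOInf_zpow {y : LaurentAtInf} (hy : y.order = -1) (n : ℤ) :
    IsBigOInf (y ^ (-n)) n := by
  have hy0 : y ≠ 0 := by rintro rfl; simp at hy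
  have key : ∀ m : ℤ, (y ^ m).order = -m := by
    have hpow : ∀ k : ℕ, (y ^ k).order = -k := fun k => by simp [hy]
    intro m
    obtain ⟨k, rfl | rfl⟩ := m.eq_nat_or_neg
    · simpa using hpow k
    · have h := HahnSeries.order_mul (pow_ne_zero k hy0) (inv_ne_zero (pow_ne_zero k hy0))
      rw [mul_inv_cancel₀ (pow_ne_zero k hy0), hpow, HahnSeries.order_one] at h
      rw [zpow_neg, zpow_natCast]
      omega
  intro k hk
  exact HahnSeries.coeff_eq_zero_of_lt_order (by rw [key]; omega)

theorem orderTop_inv_pos {y : LaurentAtInf} (hy : y.order = -1) : 0 < y⁻¹.orderTop := by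
  have h := isBigOInf_iff.mp (isBigOInf_zpow hy 1)
  rw [zpow_neg, zpow_one] at h
  exact lt_of_lt_of_le (by norm_num) h

/-- For `y` with a simple pole at infinity, `comp y` is the ring homomorphism that extends
`1 / x ↦ 1 / y` from power series in `1 / x` to their localization away from `1 / x`. -/
noncomputable def compHom {y : LaurentAtInf} (hy : y.order = -1) : LaurentAtInf →+* LaurentAtInf :=
  IsLocalization.Away.lift (S := LaurentAtInf) (PowerSeries.X : PowerSeries ℂ)
    (g := (PowerSeries.heval y⁻¹ : PowerSeries ℂ →+* LaurentAtInf)) (by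
      have : y ≠ 0 := by rintro rfl; simp at hy
      simpa [PowerSeries.heval_X _ (orderTop_inv_pos hy)] using this)

theorem compHom_ofPowerSeries {y : LaurentAtInf} (hy : y.order = -1) (g : PowerSeries ℂ) :
    compHom hy (HahnSeries.ofPowerSeries ℤ ℂ g) = PowerSeries.heval y⁻¹ g :=
  IsLocalization.Away.lift_eq (S := LaurentAtInf) (PowerSeries.X : PowerSeries ℂ) _ g

theorem compHom_single {y : LaurentAtInf} (hy : y.order = -1) (n : ℤ) :
    compHom hy (HahnSeries.single n 1) = y ^ (-n) := by
  have h : compHom hy (HahnSeries.single 1 1) = y⁻¹ := by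
    rw [← HahnSeries.ofPowerSeries_X, compHom_ofPowerSeries,
      PowerSeries.heval_X _ (orderTop_inv_pos hy)]
  rw [RatFunc.single_zpow, map_zpow₀, h, inv_zpow']

theorem compHom_apply {y : LaurentAtInf} (hy : y.order = -1) (f : LaurentAtInf) :
    compHom hy f = comp y f := by
  conv_lhs => rw [← LaurentSeries.single_order_mul_powerSeriesPart f]
  rw [map_mul, compHom_single, compHom_ofPowerSeries, comp]

theorem compHom_ofPoly {y : LaurentAtInf} (hy : y.order = -1) (p : ℂ[X]) :
    compHom hy (ofPoly p) = aeval y p := by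
  have hC : ∀ a : ℂ, compHom hy (algebraMap ℂ LaurentAtInf a) = algebraMap ℂ LaurentAtInf a := by
    intro a
    have h := compHom_ofPowerSeries hy (PowerSeries.C a)
    rw [HahnSeries.ofPowerSeries_C] at h
    rw [PowerSeries.heval_C, HahnSeries.C_apply, ← algebraMap_eq_single] at h
    rw [h, algebraMap_eq_single]
    ext k
    by_cases hk : k = 0 <;> simp [hk]
  have hx : compHom hy xInf = y := by simpa [xInf] using compHom_single hy (-1)
  rw [ofPoly, aeval_def, hom_eval₂, hx, aeval_def]
  congr 1
  ext a : 1
  exact hC a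

/-- Composition with a series that has a simple pole at infinity preserves orders. -/
theorem IsBigOInf.comp {y : LaurentAtInf} (hy : y.order = -1) {f : LaurentAtInf} {m : ℤ}
    (hf : IsBigOInf f m) : IsBigOInf (compHom hy f) m := by
  rcases eq_or_ne f 0 with rfl | h0
  · intro k _; simp
  have hm : m ≤ f.order := by
    by_contra! h
    exact HahnSeries.coeff_order_eq_zero.not.mpr h0 (hf _ h)
  rw [compHom_apply, LaguerreHahn.comp, ← add_zero m]
  refine ((isBigOInf_zpow hy _).mono hm).mul ?_
  intro k hk
  rw [PowerSeries.coeff_heval]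
  refine finsum_eq_zero_of_forall_eq_zero fun n => ?_
  simp only [HahnSeries.SummableFamily.coeff_apply,
    HahnSeries.SummableFamily.powerSeriesFamily_of_orderTop_pos (orderTop_inv_pos hy)]
  rw [HahnSeries.coeff_smul, smul_eq_mul]
  refine mul_eq_zero_of_right _ ?_
  have := isBigOInf_zpow hy n
  rw [zpow_neg, zpow_natCast, ← inv_pow] at this
  exact this k (by omega)

/-! ### The roots of the conic -/

instance : CharZero LaurentAtInf :=
  charZero_of_injective_algebraMap (algebraMap ℂ LaurentAtInf).injective

theorem ofPoly_C (a : ℂ) : ofPoly (C a) = algebraMap ℂ LaurentAtInf a := aeval_C _ _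

theorem comp_ofPoly {y : LaurentAtInf} (hy : y.order = -1) (p : ℂ[X]) :
    comp y (ofPoly p) = aeval y p := by
  rw [← compHom_apply hy, compHom_ofPoly]

theorem order_ofPoly {p : ℂ[X]} (hp : p ≠ 0) : (ofPoly p).order = -p.natDegree := by
  have h0 : (ofPoly p).coeff (-p.natDegree : ℤ) ≠ 0 := by simpa [coeff_ofPoly] using hp
  refine le_antisymm (HahnSeries.order_le_of_coeff_ne_zero h0) ?_
  by_contra! h
  have hne : ofPoly p ≠ 0 := by rintro h'; simp [h'] at h0
  exact HahnSeries.coeff_order_eq_zero.not.mpr hne (isBigOInf_ofPoly le_rfl _ h)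

/-- Two Laurent series at infinity with simple poles that are the roots of a quadratic polynomial
over `ℂ[x]` whose discriminant is not a square. The last field says that `1` and `y₂ - y₁` are
linearly independent over `ℂ[x]`, so that identities in `ℂ[x, y₁, y₂]` split into a part that is
even and a part that is odd under the exchange of the two roots. -/
structure QuadraticPair (y₁ y₂ : LaurentAtInf) : Prop where
  order_fst : y₁.order = -1
  order_snd : y₂.order = -1
  exists_half_sum : ∃ m : ℂ[X], y₁ + y₂ = 2 * ofPoly m
  exists_disc : ∃ δ : ℂ[X], (y₂ - y₁) ^ 2 = ofPoly δ
  eq_zero : ∀ p q : ℂ[X], ofPoly p + (y₂ - y₁) * ofPoly q = 0 → p = 0 ∧ q = 0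

/-- A polynomial with a simple root is not a square of a rational function. -/
theorem eq_zero_of_sq_eq_mul_sq {δ p q : ℂ[X]} {z : ℂ} (h0 : δ.eval z = 0)
    (h1 : δ.derivative.eval z ≠ 0) (h : p ^ 2 = δ * q ^ 2) : q = 0 := by
  by_contra hq
  have hδ : δ ≠ 0 := by rintro rfl; simp at h1
  have hp : p ≠ 0 := by
    rintro rfl
    simp [hδ, hq] at h
  have hm : δ.rootMultiplicity z = 1 := by
    have hpos := (rootMultiplicity_pos hδ).mpr h0
    have hle : ¬ 1 < δ.rootMultiplicity z := fun hlt =>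
      h1 ((one_lt_rootMultiplicity_iff_isRoot hδ).mp hlt).2
    omega
  have h2 := congrArg (rootMultiplicity z) h
  rw [rootMultiplicity_mul (mul_ne_zero hδ (pow_ne_zero 2 hq)), hm, pow_two, pow_two,
    rootMultiplicity_mul (mul_ne_zero hp hp), rootMultiplicity_mul (mul_ne_zero hq hq)] at h2
  omega

/-- Two Laurent series whose sum has degree at most one and whose product has degree two both have a
simple pole at infinity. -/
theorem order_eq_neg_one {y₁ y₂ : LaurentAtInf} {s t : ℂ[X]} (hs : y₁ + y₂ = ofPoly s)
    (ht : y₁ * y₂ = ofPoly t) (hsd : s.natDegree ≤ 1) (htd : t.natDegree = 2) :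
    y₁.order = -1 ∧ y₂.order = -1 := by
  have ht0 : t ≠ 0 := by rintro rfl; simp at htd
  have hmul : y₁ * y₂ ≠ 0 := by
    rw [ht, ← map_zero ofPoly]
    exact ofPoly_injective.ne ht0
  have hsum : y₁.order + y₂.order = -2 := by
    rw [← HahnSeries.order_mul (left_ne_zero_of_mul hmul) (right_ne_zero_of_mul hmul), ht,
      order_ofPoly ht0, htd]
    rfl
  -- were the orders different, the smaller one would be the order of the sum
  have key : ∀ u v : LaurentAtInf, u ≠ 0 → u + v = ofPoly s → u.order + v.order = -2 →
      -1 ≤ u.order := by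
    intro u v hu huv ho
    by_contra! h
    have h1 := isBigOInf_ofPoly hsd u.order (by simpa using h)
    rw [← huv, HahnSeries.coeff_add, HahnSeries.coeff_eq_zero_of_lt_order (x := v) (by omega),
      add_zero] at h1
    exact HahnSeries.coeff_order_eq_zero.not.mpr hu h1
  have h1 := key y₁ y₂ (left_ne_zero_of_mul hmul) hs hsum
  have h2 := key y₂ y₁ (right_ne_zero_of_mul hmul) (by rw [add_comm, hs]) (by omega)
  omega

theorem Conic.IsRoots.quadraticPair {K : Conic} {y₁ y₂ : LaurentAtInf} (hy : K.IsRoots y₁ y₂) :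
    QuadraticPair y₁ y₂ := by
  obtain ⟨hs, ht⟩ := hy
  have ha := K.a_ne
  have hord := order_eq_neg_one hs ht
    (by
      refine (natDegree_C_mul_le _ _).trans ?_
      exact natDegree_linear_le)
    (by
      rw [natDegree_C_mul (one_div_ne_zero ha)]
      exact natDegree_quadratic K.c_ne)
  set δ : ℂ[X] := C (4 / K.a ^ 2) * (C (K.b ^ 2 - K.a * K.c) * X ^ 2
    + C (2 * (K.b * K.d - K.a * K.e)) * X + C (K.d ^ 2 - K.a * K.f)) with hδ
  have hdisc : (y₂ - y₁) ^ 2 = ofPoly δ := by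
    have : (y₂ - y₁) ^ 2 = (y₁ + y₂) ^ 2 - 4 * (y₁ * y₂) := by ring
    rw [this, hs, ht, ← map_pow, show (4 : LaurentAtInf) = ofPoly 4 from (map_ofNat ofPoly 4).symm,
      ← map_mul, ← map_sub]
    congr 1
    refine Polynomial.funext fun x => ?_
    simp only [hδ, eval_sub, eval_mul, eval_pow, eval_add, eval_C, eval_X, eval_ofNat]
    field_simp
    ring
  refine ⟨hord.1, hord.2, ⟨C (-1 / K.a) * (C K.b * X + C K.d), ?_⟩, ⟨δ, hdisc⟩, ?_⟩
  · rw [hs, show (2 : LaurentAtInf) = ofPoly 2 from (map_ofNat ofPoly 2).symm, ← map_mul]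
    congr 1
    refine Polynomial.funext fun x => ?_
    simp only [eval_mul, eval_add, eval_C, eval_X, eval_ofNat]
    ring
  -- the discriminant has a simple root, because `λ ≠ 0` and `τ ≠ 0`
  · have hlam := K.lambda_ne
    have h4 : (4 / K.a ^ 2 : ℂ) ≠ 0 := div_ne_zero (by norm_num) (pow_ne_zero 2 ha)
    obtain ⟨z, hz⟩ : ∃ z, δ.eval z = 0 := by
      refine IsAlgClosed.exists_root δ ?_
      rw [hδ, degree_C_mul h4, degree_quadratic hlam]
      norm_num
    have hz' : δ.derivative.eval z ≠ 0 := by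
      intro h
      simp only [hδ, derivative_mul, derivative_C, derivative_add, derivative_X_pow, derivative_X,
        eval_mul, eval_add, eval_C, eval_X, eval_pow, zero_mul, zero_add, add_zero,
        mul_one, Nat.cast_ofNat, Nat.add_one_sub_one, pow_one,
        eval_ofNat, map_ofNat, mul_eq_zero, h4, false_or] at h hz
      refine K.tau_ne (div_eq_zero_iff.mpr (Or.inl ?_))
      linear_combination (K.b ^ 2 - K.a * K.c) * hz
        - ((K.b ^ 2 - K.a * K.c) * z + (K.b * K.d - K.a * K.e)) / 2 * h
    intro p q hpq
    have hq : q = 0 := by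
      refine eq_zero_of_sq_eq_mul_sq (p := p) hz hz' (ofPoly_injective ?_)
      rw [map_mul, map_pow, map_pow, ← hdisc]
      linear_combination (ofPoly p - (y₂ - y₁) * ofPoly q) * hpq
    subst hq
    refine ⟨ofPoly_injective ?_, rfl⟩
    simpa using hpq

namespace QuadraticPair

variable {y₁ y₂ : LaurentAtInf}

theorem symm (h : QuadraticPair y₁ y₂) : QuadraticPair y₂ y₁ := by
  obtain ⟨m, hm⟩ := h.exists_half_sum
  obtain ⟨δ, hδ⟩ := h.exists_disc
  refine ⟨h.order_snd, h.order_fst, ⟨m, by rw [add_comm, hm]⟩, ⟨δ, by rw [← hδ]; ring⟩, ?_⟩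
  intro p q hpq
  have := h.eq_zero p (-q) (by rw [map_neg]; linear_combination hpq)
  simpa using this

theorem sub_ne_zero (h : QuadraticPair y₁ y₂) : y₂ - y₁ ≠ 0 := by
  intro h0
  exact one_ne_zero (h.eq_zero 0 1 (by simp [h0])).2

theorem isBigOInf_fst (h : QuadraticPair y₁ y₂) : IsBigOInf y₁ (-1) := by
  simpa using isBigOInf_zpow h.order_fst (-1)

theorem isBigOInf_sub (h : QuadraticPair y₁ y₂) : IsBigOInf (y₂ - y₁) (-1) :=
  h.symm.isBigOInf_fst.sub h.isBigOInf_fst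

/-- A polynomial is bounded in degree by the order at infinity of its product with `(y₂ - y₁) ^ 2`,
since the latter is a nonzero polynomial. -/
theorem natDegree_le_of_sq_mul (h : QuadraticPair y₁ y₂) {p : ℂ[X]} {N : ℕ}
    (hp : IsBigOInf ((y₂ - y₁) ^ 2 * ofPoly p) (-N)) : p.natDegree ≤ N := by
  obtain ⟨δ, hδ⟩ := h.exists_disc
  have hδ0 : δ ≠ 0 := by
    rintro rfl
    rw [map_zero] at hδ
    exact h.sub_ne_zero (pow_eq_zero_iff two_ne_zero |>.mp hδ)
  rcases eq_or_ne p 0 with rfl | hp0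
  · simp
  rw [hδ, ← map_mul] at hp
  have h3 := natDegree_le_of_isBigOInf hp
  rw [natDegree_mul hδ0 hp0] at h3
  omega

theorem natDegree_le_of_mul (h : QuadraticPair y₁ y₂) {p : ℂ[X]} {N : ℕ}
    (hp : IsBigOInf ((y₂ - y₁) * ofPoly p) (-N)) : p.natDegree ≤ N + 1 := by
  refine h.natDegree_le_of_sq_mul ?_
  rw [pow_two, mul_assoc]
  exact (h.isBigOInf_sub.mul hp).mono (by push_cast; omega)

/-- The pairs `(m - Δ d, m + Δ d)` with `m, d ∈ ℂ[x]` and `Δ = y₂ - y₁`, that is, the pairs of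
conjugate elements of `ℂ[x] ⊕ Δ ℂ[x]`. -/
noncomputable def conjPairs (h : QuadraticPair y₁ y₂) :
    Subalgebra ℂ (LaurentAtInf × LaurentAtInf) where
  carrier := {z | ∃ m d : ℂ[X], z.1 = ofPoly m - (y₂ - y₁) * ofPoly d ∧
    z.2 = ofPoly m + (y₂ - y₁) * ofPoly d}
  mul_mem' := by
    rintro z w ⟨m, d, hz1, hz2⟩ ⟨m', d', hw1, hw2⟩
    obtain ⟨δ, hδ⟩ := h.exists_disc
    refine ⟨m * m' + δ * (d * d'), m * d' + d * m', ?_, ?_⟩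
    · simp only [Prod.fst_mul, hz1, hw1, map_add, map_mul, ← hδ]
      ring
    · simp only [Prod.snd_mul, hz2, hw2, map_add, map_mul, ← hδ]
      ring
  add_mem' := by
    rintro z w ⟨m, d, hz1, hz2⟩ ⟨m', d', hw1, hw2⟩
    refine ⟨m + m', d + d', ?_, ?_⟩
    · simp only [Prod.fst_add, hz1, hw1, map_add]
      ring
    · simp only [Prod.snd_add, hz2, hw2, map_add]
      ring
  algebraMap_mem' a := ⟨C a, 0, by simp [ofPoly_C], by simp [ofPoly_C]⟩

theorem mem_conjPairs (h : QuadraticPair y₁ y₂) {u v : LaurentAtInf} :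
    (u, v) ∈ h.conjPairs ↔ ∃ m d : ℂ[X], u = ofPoly m - (y₂ - y₁) * ofPoly d ∧
      v = ofPoly m + (y₂ - y₁) * ofPoly d := Iff.rfl

theorem ofPoly_mem_conjPairs (h : QuadraticPair y₁ y₂) (p : ℂ[X]) :
    (ofPoly p, ofPoly p) ∈ h.conjPairs :=
  h.mem_conjPairs.mpr ⟨p, 0, by simp, by simp⟩

theorem aeval_mem_conjPairs (h : QuadraticPair y₁ y₂) (p : ℂ[X]) :
    (aeval y₁ p, aeval y₂ p) ∈ h.conjPairs := by
  have hy : (y₁, y₂) ∈ h.conjPairs := by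
    obtain ⟨m, hm⟩ := h.exists_half_sum
    have h2 : 2 * ofPoly (C (1 / 2)) = 1 := by
      rw [ofPoly_C, map_div₀, map_one, map_ofNat]
      norm_num
    exact h.mem_conjPairs.mpr ⟨m, C (1 / 2),
      by linear_combination ofPoly (C (1 / 2)) * hm - (y₁ - ofPoly m) * h2,
      by linear_combination ofPoly (C (1 / 2)) * hm - (y₂ - ofPoly m) * h2⟩
  have hp := Algebra.adjoin_le (Set.singleton_subset_iff.mpr hy)
    (aeval_mem_adjoin_singleton ℂ (y₁, y₂) (p := p))
  rwa [aeval_prod_apply] at hp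

theorem swap_aeval_mem_conjPairs (h : QuadraticPair y₁ y₂) (p : ℂ[X]) :
    (aeval y₂ p, aeval y₁ p) ∈ h.conjPairs := by
  obtain ⟨m, d, h1, h2⟩ := h.mem_conjPairs.mp (h.aeval_mem_conjPairs p)
  exact h.mem_conjPairs.mpr ⟨m, -d, by rw [h2, map_neg]; ring, by rw [h1, map_neg]; ring⟩

theorem exists_of_diag_mem (h : QuadraticPair y₁ y₂) {u : LaurentAtInf}
    (hu : (u, u) ∈ h.conjPairs) : ∃ m : ℂ[X], u = ofPoly m := by
  obtain ⟨m, d, h1, h2⟩ := h.mem_conjPairs.mp hu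
  exact ⟨m, by linear_combination (h1 + h2) / 2⟩

/-- The divided difference operator maps polynomials to polynomials. -/
theorem exists_divDiff_aeval (h : QuadraticPair y₁ y₂) (p : ℂ[X]) :
    ∃ d : ℂ[X], (aeval y₂ p - aeval y₁ p) / (y₂ - y₁) = ofPoly d := by
  obtain ⟨m, d, h1, h2⟩ := h.mem_conjPairs.mp (h.aeval_mem_conjPairs p)
  refine ⟨2 * d, ?_⟩
  rw [div_eq_iff h.sub_ne_zero, h1, h2]
  simp only [map_mul, map_ofNat]
  ring

end QuadraticPair

/-! ### Orthogonal polynomials and their recurrence relation -/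

theorem coeff_stieltjes_succ (u : ℕ → ℂ) (n : ℕ) : (stieltjes u).coeff (n + 1 : ℤ) = u n := by
  have := HahnSeries.ofPowerSeries_apply_coeff (Γ := ℤ) (PowerSeries.X * PowerSeries.mk u) (n + 1)
  rw [PowerSeries.coeff_succ_X_mul, PowerSeries.coeff_mk] at this
  simpa [stieltjes] using this

theorem isBigOInf_stieltjes (u : ℕ → ℂ) : IsBigOInf (stieltjes u) 1 := by
  intro k hk
  rw [stieltjes, PowerSeries.coeff_coe]
  split_ifs with h
  · rfl
  · obtain rfl : k = 0 := by omega
    simp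

theorem coeff_ofPoly_mul (R : ℂ[X]) (f : LaurentAtInf) {n : ℕ} (hR : R.degree < n) (k : ℤ) :
    (ofPoly R * f).coeff k = ∑ j : Fin n, R.coeff j * f.coeff (k + j) := by
  rcases eq_or_ne R 0 with rfl | hR0
  · simp
  conv_lhs => rw [R.as_sum_range' n ((natDegree_lt_iff_degree_lt hR0).mpr hR)]
  rw [map_sum, Finset.sum_mul, HahnSeries.coeff_sum, Finset.sum_range]
  refine Finset.sum_congr rfl fun j _ => ?_
  have h : HahnSeries.coeff (HahnSeries.single (-(j : ℕ) : ℤ) (R.coeff j) * f)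
    (k + j + -(j : ℕ)) = _ := HahnSeries.coeff_single_mul_add
  rw [add_neg_cancel_right] at h
  rw [ofPoly_monomial, h]

/-- Since the Hankel determinants do not vanish, the Padé conditions of order one better than those
of the orthogonal polynomial admit only the trivial solution. -/
theorem IsRegular.eq_zero {u : ℕ → ℂ} (hu : IsRegular u) {R R₁ : ℂ[X]} {n : ℕ}
    (hR : R.degree < n) (h : IsBigOInf (ofPoly R * stieltjes u - ofPoly R₁) (n + 1)) :
    R = 0 ∧ R₁ = 0 := by
  have hR0 : R = 0 := by
    rcases n with _ | n
    · simpa using hR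
    by_contra hne
    have hv : (Matrix.of fun i j : Fin (n + 1) => u ((i : ℕ) + (j : ℕ))).mulVec
        (fun j => R.coeff j) = 0 := by
      ext i
      have hi := h (i + 1) (by have := i.2; push_cast; omega)
      rw [HahnSeries.coeff_sub, coeff_ofPoly, if_neg (by omega), sub_zero,
        coeff_ofPoly_mul R _ hR] at hi
      rw [Matrix.mulVec, dotProduct, Pi.zero_apply, ← hi]
      refine Finset.sum_congr rfl fun j _ => ?_
      rw [show (i + 1 + j : ℤ) = ((i + j : ℕ) : ℤ) + 1 by push_cast; ring, coeff_stieltjes_succ,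
        Matrix.of_apply, mul_comm]
    have h0 := Matrix.eq_zero_of_mulVec_eq_zero (hu.2 n) hv
    refine hne (Polynomial.ext fun k => ?_)
    by_cases hk : k < n + 1
    · exact congrFun h0 ⟨k, hk⟩
    · exact coeff_eq_zero_of_degree_lt (hR.trans_le (by exact_mod_cast not_lt.mp hk))
  subst hR0
  refine ⟨rfl, eq_zero_of_isBigOInf_one ?_⟩
  simpa using (h.neg.mono (n := 1) (by omega))

/-- `P (n - 1)`: the orthogonal polynomials with the index shifted to start at `0`. -/
def shiftP (P : ℤ → ℂ[X]) (n : ℕ) : ℂ[X] := P ((n : ℤ) - 1)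

/-- `P1 (n - 2)`: the associated polynomials with the index shifted to start at `0`. The entry of
index `0` is `-1`, which makes the recurrence relation, the structure relations and the formula for
the functions of the second kind hold from the first index on. -/
noncomputable def shiftP1 (P1 : ℤ → ℂ[X]) (n : ℕ) : ℂ[X] := if n = 0 then -1 else P1 ((n : ℤ) - 2)

/-- The function of the second kind of index `n - 1`. -/
noncomputable def shiftQ (u : ℕ → ℂ) (P P1 : ℤ → ℂ[X]) (n : ℕ) : LaurentAtInf :=
  ofPoly (shiftP P n) * stieltjes u - ofPoly (shiftP1 P1 n)

/-- The three-term recurrence relation, for the sequences with shifted indices. -/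
def ShiftRec (P P1 : ℤ → ℂ[X]) (β γ : ℕ → ℂ) : Prop := ∀ n : ℕ,
  shiftP P (n + 2) = (X - C (β n)) * shiftP P (n + 1) - C (γ n) * shiftP P n ∧
  shiftP1 P1 (n + 2) = (X - C (β n)) * shiftP1 P1 (n + 1) - C (γ n) * shiftP1 P1 n

section

variable {u : ℕ → ℂ} {P P1 : ℤ → ℂ[X]}

theorem shiftP_succ (n : ℕ) : shiftP P (n + 1) = P n := by simp [shiftP]

theorem shiftP1_zero : shiftP1 P1 0 = -1 := by simp [shiftP1]

theorem shiftP1_succ (n : ℕ) : shiftP1 P1 (n + 1) = P1 ((n : ℤ) - 1) := by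
  simp only [shiftP1, Nat.add_eq_zero_iff, one_ne_zero, and_false, if_false]
  congr 1
  push_cast
  ring

variable (hP : IsSMOP (stieltjes u) P P1)
include hP

theorem IsSMOP.shiftP_zero : shiftP P 0 = 0 := by simpa [shiftP] using hP.P_neg_one

theorem IsSMOP.shiftP_one : shiftP P 1 = 1 := by
  have h := hP.natDegree_eq 0
  have hm := hP.monic 0
  rw [shiftP_succ]
  exact hm.natDegree_eq_zero.mp h

theorem IsSMOP.shiftP1_one : shiftP1 P1 1 = 0 := by
  rw [shiftP1_succ]; exact hP.P1_neg_one

theorem IsSMOP.degree_shiftP_lt (n : ℕ) : (shiftP P n).degree < n := by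
  rcases n with _ | n
  · simp [hP.shiftP_zero]
  · rw [shiftP_succ, degree_eq_natDegree (hP.monic n).ne_zero, hP.natDegree_eq n]
    exact_mod_cast Nat.lt_succ_self n

theorem IsSMOP.secondKind_eq (n : ℕ) :
    secondKind (stieltjes u) P P1 ((n : ℤ) - 1) = shiftQ u P P1 n := by
  rcases n with _ | n
  · simp [secondKind, shiftQ, shiftP1_zero, hP.shiftP_zero]
  · rw [shiftQ, shiftP_succ, shiftP1_succ, secondKind, if_neg (by push_cast; omega)]
    simp

theorem IsSMOP.isBigOInf_shiftQ (n : ℕ) : IsBigOInf (shiftQ u P P1 n) n := by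
  rcases n with _ | n
  · rw [shiftQ, shiftP1_zero, hP.shiftP_zero]
    intro k hk
    simp [HahnSeries.coeff_one, (by simpa using hk.ne : k ≠ 0)]
  · have hne : ofPoly (P n) ≠ 0 := by
      rw [← map_zero ofPoly]
      exact ofPoly_injective.ne (hP.monic n).ne_zero
    have h := (isBigOInf_ofPoly (hP.natDegree_eq n).le).mul (hP.pade n)
    rw [mul_sub, mul_div_cancel₀ _ hne] at h
    rw [shiftQ, shiftP_succ, shiftP1_succ]
    exact h.mono (by push_cast; omega)

/-- The leading coefficient of a function of the second kind does not vanish. -/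
theorem IsSMOP.coeff_shiftQ_ne_zero (hu : IsRegular u) (n : ℕ) :
    (shiftQ u P P1 n).coeff n ≠ 0 := by
  intro h
  have h1 : IsBigOInf (shiftQ u P P1 n) (n + 1) := by
    intro k hk
    rcases (show k ≤ n by omega).lt_or_eq with h2 | rfl
    · exact hP.isBigOInf_shiftQ n k h2
    · exact h
  obtain ⟨h2, h3⟩ := hu.eq_zero (hP.degree_shiftP_lt n) h1
  rcases n with _ | n
  · simp [shiftP1_zero] at h3
  · exact (hP.monic n).ne_zero (by rwa [shiftP_succ] at h2)

theorem IsSMOP.coeff_shiftQ_zero : (shiftQ u P P1 0).coeff 0 = 1 := by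
  simp [shiftQ, shiftP1_zero, hP.shiftP_zero]

theorem IsSMOP.coeff_shiftQ_one (hu : IsRegular u) : (shiftQ u P P1 1).coeff 1 = 1 := by
  have := coeff_stieltjes_succ u 0
  simp only [Nat.cast_zero, zero_add] at this
  simp [shiftQ, hP.shiftP_one, hP.shiftP1_one, this, hu.1]

/-- Two columns determine the next one: with `b` and `g` chosen to cancel the leading terms, the
defect of the recurrence relation is a solution of the Padé conditions of too small a degree. The
number `g` is the quotient of consecutive leading coefficients of the functions of the second
kind. -/
theorem IsSMOP.exists_rec (hu : IsRegular u) (n : ℕ) : ∃ b : ℂ, ∀ g : ℂ,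
    g * (shiftQ u P P1 n).coeff n = (shiftQ u P P1 (n + 1)).coeff (n + 1 : ℕ) →
    shiftP P (n + 2) = (X - C b) * shiftP P (n + 1) - C g * shiftP P n ∧
    shiftP1 P1 (n + 2) = (X - C b) * shiftP1 P1 (n + 1) - C g * shiftP1 P1 n := by
  -- `b` cancels the coefficient of `x ^ n`
  set t := shiftP P (n + 2) - X * shiftP P (n + 1) with ht
  have hm : (shiftP P (n + 1)).Monic := by rw [shiftP_succ]; exact hP.monic n
  have hd : (shiftP P (n + 1)).natDegree = n := by rw [shiftP_succ]; exact hP.natDegree_eq n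
  have hm' : (shiftP P (n + 2)).Monic := by rw [shiftP_succ]; exact hP.monic (n + 1 : ℕ)
  have hd' : (shiftP P (n + 2)).natDegree = n + 1 := by
    rw [shiftP_succ]; exact hP.natDegree_eq (n + 1 : ℕ)
  have hmX : (X * shiftP P (n + 1)).Monic := monic_X.mul hm
  have hdX : (X * shiftP P (n + 1)).natDegree = n + 1 := by
    rw [natDegree_X_mul hm.ne_zero, hd]
  refine ⟨-t.coeff n, fun g hg => ?_⟩
  set R := t + C (-t.coeff n) * shiftP P (n + 1) + C g * shiftP P n with hR
  set R₁ := shiftP1 P1 (n + 2) - X * shiftP1 P1 (n + 1) + C (-t.coeff n) * shiftP1 P1 (n + 1)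
    + C g * shiftP1 P1 n with hR₁
  have hdeg : R.degree < n := by
    rw [degree_lt_iff_coeff_zero]
    intro k hk
    have h0 : (shiftP P n).coeff k = 0 :=
      coeff_eq_zero_of_degree_lt ((hP.degree_shiftP_lt n).trans_le (by exact_mod_cast hk))
    rw [hR, coeff_add, coeff_add, coeff_C_mul, coeff_C_mul, h0, mul_zero, add_zero]
    rcases hk.eq_or_lt with rfl | hk
    · have : (shiftP P (n + 1)).coeff n = 1 := by
        simpa [hd] using hm.coeff_natDegree
      rw [this]; ring
    · rw [coeff_eq_zero_of_natDegree_lt (p := shiftP P (n + 1)) (by omega), mul_zero, add_zero, ht,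
        coeff_sub]
      rcases (show n + 1 ≤ k by omega).eq_or_lt with rfl | hk
      · have h1 := hm'.coeff_natDegree
        have h2 := hmX.coeff_natDegree
        rw [hd'] at h1
        rw [hdX] at h2
        rw [h1, h2, sub_self]
      · rw [coeff_eq_zero_of_natDegree_lt (by omega), coeff_eq_zero_of_natDegree_lt (by omega),
          sub_zero]
  have hRS : ofPoly R * stieltjes u - ofPoly R₁ = shiftQ u P P1 (n + 2)
      - ofPoly X * shiftQ u P P1 (n + 1) + ofPoly (C (-t.coeff n)) * shiftQ u P P1 (n + 1)
      + ofPoly (C g) * shiftQ u P P1 n := by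
    simp only [hR, hR₁, ht, shiftQ, map_add, map_sub, map_mul]
    ring
  have hbig : IsBigOInf (ofPoly R * stieltjes u - ofPoly R₁) (n + 1) := by
    rw [hRS]
    have hc : ∀ a : ℂ, IsBigOInf (ofPoly (C a)) 0 := fun a => by
      simpa using isBigOInf_ofPoly (p := C a) (m := 0) (by simp)
    have h2 : IsBigOInf (shiftQ u P P1 (n + 2)) (n + 1) :=
      (hP.isBigOInf_shiftQ (n + 2)).mono (by push_cast; omega)
    have h1 : IsBigOInf (ofPoly (C (-t.coeff n)) * shiftQ u P P1 (n + 1)) (n + 1) :=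
      ((hc _).mul (hP.isBigOInf_shiftQ (n + 1))).mono (by push_cast; omega)
    -- the choice of `g` cancels the coefficients of `x ^ (-n)`
    have h0 : IsBigOInf (ofPoly (C g) * shiftQ u P P1 n - ofPoly X * shiftQ u P P1 (n + 1))
        (n + 1) := by
      intro k hk
      have e1 : (ofPoly (C g) * shiftQ u P P1 n).coeff k = g * (shiftQ u P P1 n).coeff k := by
        rw [coeff_ofPoly_mul (C g) _ (n := 1) (by exact degree_C_lt)]
        simp
      have e2 : (ofPoly X * shiftQ u P P1 (n + 1)).coeff k
          = (shiftQ u P P1 (n + 1)).coeff (k + 1) := by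
        rw [coeff_ofPoly_mul X _ (n := 2) (by rw [degree_X]; norm_num)]
        simp [Fin.sum_univ_two]
      rw [HahnSeries.coeff_sub, e1, e2]
      rcases (show k ≤ n by omega).lt_or_eq with h | rfl
      · rw [hP.isBigOInf_shiftQ n k h, hP.isBigOInf_shiftQ (n + 1) _ (by push_cast; omega)]
        ring
      · rw [hg]
        push_cast
        ring
    have := (h2.add h1).add h0
    convert this using 1
    ring
  obtain ⟨h1, h2⟩ := hu.eq_zero hdeg hbig
  constructor
  · linear_combination h1
  · linear_combination h2

theorem IsSMOP.exists_isRecurrenceCoeffs (hu : IsRegular u) :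
    ∃ β γ : ℕ → ℂ, IsRecurrenceCoeffs P P1 β γ := by
  choose b hb using hP.exists_rec hu
  set h : ℕ → ℂ := fun n => (shiftQ u P P1 n).coeff n with hh
  have hne : ∀ n, h n ≠ 0 := hP.coeff_shiftQ_ne_zero hu
  have hrec := fun n => hb n (h (n + 1) / h n) (div_mul_cancel₀ _ (hne n))
  refine ⟨b, fun n => h (n + 1) / h n, ?_, fun n => div_ne_zero (hne _) (hne _), fun n => ?_,
    fun n hn => ?_⟩
  · have h1 : h 1 = 1 := by simpa [hh] using hP.coeff_shiftQ_one hu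
    have h0 : h 0 = 1 := by simpa [hh] using hP.coeff_shiftQ_zero
    simp [h0, h1]
  · have := (hrec n).1
    rw [shiftP_succ, shiftP_succ] at this
    simpa [shiftP] using this
  · obtain ⟨n, rfl⟩ := Nat.exists_eq_add_of_le' hn
    have := (hrec (n + 1)).2
    rw [shiftP1_succ, shiftP1_succ, shiftP1_succ] at this
    convert this using 3
    · push_cast; ring
    · congr 1; push_cast; ring

theorem IsRecurrenceCoeffs.shiftRec (hu : IsRegular u) {β γ : ℕ → ℂ}
    (h : IsRecurrenceCoeffs P P1 β γ) : ShiftRec P P1 β γ := by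
  intro n
  constructor
  · have := h.rec_P n
    rw [shiftP_succ, shiftP_succ]
    simpa [shiftP] using this
  · rcases n with _ | n
    -- at the first index the claim is that the numerator of the first approximant is `1`
    · obtain ⟨b, hb⟩ := hP.exists_rec hu 0
      have := (hb 1 (by simpa using (hP.coeff_shiftQ_zero.trans (hP.coeff_shiftQ_one hu).symm))).2
      simpa [h.gamma_zero, hP.shiftP1_one] using this
    · have := h.rec_P1 (n + 1) (by omega)
      rw [shiftP1_succ, shiftP1_succ, shiftP1_succ]
      convert this using 3
      · push_cast; ring
      · congr 1; push_cast; ring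

end

/-- The Wronskian (Casorati determinant) of `P` and `P1` is a nonzero constant. -/
theorem ShiftRec.exists_wronskian {P P1 : ℤ → ℂ[X]} {β γ : ℕ → ℂ} (h : ShiftRec P P1 β γ)
    (hγ : ∀ n, γ n ≠ 0) (h0 : shiftP P 1 = 1) (h1 : shiftP1 P1 1 = 0) (n : ℕ) :
    ∃ w : ℂ, w ≠ 0 ∧
      shiftP P (n + 1) * shiftP1 P1 n - shiftP1 P1 (n + 1) * shiftP P n = C w := by
  induction n with
  | zero => exact ⟨-1, by simp, by simp [h0, h1, shiftP1_zero]⟩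
  | succ n ih =>
    obtain ⟨w, hw, e⟩ := ih
    refine ⟨γ n * w, mul_ne_zero (hγ n) hw, ?_⟩
    rw [C_mul, ← e, (h n).1, (h n).2]
    ring

/-! ### Existence of the structure relations -/

/-- The structure relation for one pair of consecutive columns `(p', r')`, `(p, r)` of the table of
orthogonal and associated polynomials. The polynomial `c` stands for `C / 2`. -/
def StructureRel (y₁ y₂ : LaurentAtInf) (A B c D p' r' p r l π Θ : ℂ[X]) : Prop :=
  ofPoly A * ((aeval y₂ p - aeval y₁ p) / (y₂ - y₁)) =
      (ofPoly l + (y₂ - y₁) * ofPoly π) * aeval y₁ p - ofPoly c * aeval y₂ p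
        - ofPoly B * aeval y₂ r + ofPoly Θ * aeval y₁ p' ∧
  ofPoly A * ((aeval y₂ r - aeval y₁ r) / (y₂ - y₁)) =
      (ofPoly l + (y₂ - y₁) * ofPoly π) * aeval y₁ r + ofPoly c * aeval y₂ r
        + ofPoly D * aeval y₂ p + ofPoly Θ * aeval y₁ r'

/-- Bounds at infinity for the two numerators in Cramer's rule for the structure relation. The
terms of growth `x ^ (2 n)` cancel: after substituting `r = p s - q` they form the Riccati equation,
and what remains pairs a polynomial of degree about `n` with a function of the second kind of order
about `-n`. -/
theorem isBigOInf_cramer {Δ A B c D p₁ p₂ r₁ r₂ dp dr s₁ s₂ p' r' : LaurentAtInf} {N n : ℤ}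
    (hΔ : IsBigOInf Δ (-1)) (hA : IsBigOInf A (-N)) (hB : IsBigOInf B (-N)) (hc : IsBigOInf c (-N))
    (hp₁ : IsBigOInf p₁ (-n)) (hp₂ : IsBigOInf p₂ (-n)) (hp' : IsBigOInf p' (1 - n))
    (hs₁ : IsBigOInf s₁ 0) (hs₂ : IsBigOInf s₂ 0) (hn : 0 ≤ n)
    (hq₁ : IsBigOInf (p₁ * s₁ - r₁) (n + 1)) (hq₂ : IsBigOInf (p₂ * s₂ - r₂) (n + 1))
    (hq' : IsBigOInf (p' * s₁ - r') n)
    (hdp : Δ * dp = p₂ - p₁) (hdr : Δ * dr = r₂ - r₁)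
    (hric : A * (s₂ - s₁) = Δ * (B * (s₁ * s₂) + c * (s₁ + s₂) + D)) :
    IsBigOInf (Δ * ((A * dr - c * r₂ - D * p₂) * p₁ - (A * dp + c * p₂ + B * r₂) * r₁))
      (-(N + 1)) ∧
    IsBigOInf (Δ * ((A * dp + c * p₂ + B * r₂) * r' - (A * dr - c * r₂ - D * p₂) * p'))
      (-(N + 1)) := by
  have hr₂ : IsBigOInf r₂ (-n) := by
    have := (hp₂.mul hs₂).sub (hq₂.mono (n := -n + 0) (by omega))
    simpa using this
  constructor
  · have e : Δ * ((A * dr - c * r₂ - D * p₂) * p₁ - (A * dp + c * p₂ + B * r₂) * r₁) =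
        A * (p₂ * (p₁ * s₁ - r₁)) - A * (p₁ * (p₂ * s₂ - r₂))
        + Δ * (c * (p₁ * (p₂ * s₂ - r₂))) + Δ * (c * (p₂ * (p₁ * s₁ - r₁)))
        + Δ * (B * (p₂ * (s₂ * (p₁ * s₁ - r₁)))) + Δ * (B * (p₁ * (s₁ * (p₂ * s₂ - r₂))))
        - Δ * (B * ((p₁ * s₁ - r₁) * (p₂ * s₂ - r₂))) := by
      linear_combination A * p₁ * hdr - A * r₁ * hdp + p₁ * p₂ * hric
    rw [e]
    refine ((((((?_ : IsBigOInf _ _).sub ?_).add ?_).add ?_).add ?_).add ?_).sub ?_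
    · exact (hA.mul (hp₂.mul hq₁)).mono (by omega)
    · exact (hA.mul (hp₁.mul hq₂)).mono (by omega)
    · exact (hΔ.mul (hc.mul (hp₁.mul hq₂))).mono (by omega)
    · exact (hΔ.mul (hc.mul (hp₂.mul hq₁))).mono (by omega)
    · exact (hΔ.mul (hB.mul (hp₂.mul (hs₂.mul hq₁)))).mono (by omega)
    · exact (hΔ.mul (hB.mul (hp₁.mul (hs₁.mul hq₂)))).mono (by omega)
    · exact (hΔ.mul (hB.mul (hq₁.mul hq₂))).mono (by omega)
  · have e : Δ * ((A * dp + c * p₂ + B * r₂) * r' - (A * dr - c * r₂ - D * p₂) * p') =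
        A * (p' * (p₂ * s₂ - r₂)) - A * (p' * (p₁ * s₁ - r₁)) - Δ * (c * (p' * (p₂ * s₂ - r₂)))
        - Δ * (B * (p' * (s₁ * (p₂ * s₂ - r₂)))) - A * (p₂ * (p' * s₁ - r'))
        + A * (p₁ * (p' * s₁ - r')) - Δ * (c * (p₂ * (p' * s₁ - r')))
        - Δ * (B * (r₂ * (p' * s₁ - r'))) := by
      linear_combination A * r' * hdp - A * p' * hdr - p₂ * p' * hric
    rw [e]
    refine (((((((?_ : IsBigOInf _ _).sub ?_).sub ?_).sub ?_).sub ?_).add ?_).sub ?_).sub ?_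
    · exact (hA.mul (hp'.mul hq₂)).mono (by omega)
    · exact (hA.mul (hp'.mul hq₁)).mono (by omega)
    · exact (hΔ.mul (hc.mul (hp'.mul hq₂))).mono (by omega)
    · exact (hΔ.mul (hB.mul (hp'.mul (hs₁.mul hq₂)))).mono (by omega)
    · exact (hA.mul (hp₂.mul hq')).mono (by omega)
    · exact (hA.mul (hp₁.mul hq')).mono (by omega)
    · exact (hΔ.mul (hc.mul (hp₂.mul hq'))).mono (by omega)
    · exact (hΔ.mul (hB.mul (hr₂.mul hq'))).mono (by omega)

theorem IsBigOInf.C_mul {f : LaurentAtInf} {m : ℤ} (hf : IsBigOInf f m) (a : ℂ) :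
    IsBigOInf (ofPoly (C a) * f) m := by
  simpa using (isBigOInf_ofPoly (p := C a) (m := 0) (by simp)).mul hf

namespace QuadraticPair

variable {y₁ y₂ : LaurentAtInf}

/-- Solvability of the structure relation by Cramer's rule. The determinant is the Wronskian `w`.
The numerator for `Θ` is invariant under the exchange of `y₁` and `y₂`, so that it is a polynomial
in `x`. -/
theorem exists_structureRel (h : QuadraticPair y₁ y₂) {A B c D p' r' p r : ℂ[X]}
    {s : LaurentAtInf} {w : ℂ} {n N : ℕ} (hw : w ≠ 0) (hW : p * r' - r * p' = C w)
    (hA : A.natDegree ≤ N) (hB : B.natDegree ≤ N) (hc : c.natDegree ≤ N)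
    (hp : IsBigOInf (ofPoly p) (-n)) (hp' : IsBigOInf (ofPoly p') (1 - n))
    (hs : IsBigOInf s 0) (hq : IsBigOInf (ofPoly p * s - ofPoly r) (n + 1))
    (hq' : IsBigOInf (ofPoly p' * s - ofPoly r') n)
    (hric : ofPoly A * (comp y₂ s - comp y₁ s) = (y₂ - y₁) * (ofPoly B * (comp y₁ s * comp y₂ s)
      + ofPoly c * (comp y₁ s + comp y₂ s) + ofPoly D)) :
    ∃ l π Θ : ℂ[X], StructureRel y₁ y₂ A B c D p' r' p r l π Θ ∧
      l.natDegree ≤ N + 2 ∧ π.natDegree ≤ N + 2 ∧ Θ.natDegree ≤ N + 2 := by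
  obtain ⟨dp, hdp⟩ := h.exists_divDiff_aeval p
  obtain ⟨dr, hdr⟩ := h.exists_divDiff_aeval r
  have hΔ := h.sub_ne_zero
  have hdp' := (div_eq_iff hΔ).mp hdp
  have hdr' := (div_eq_iff hΔ).mp hdr
  -- the two right-hand sides of the linear system, at `y₁` and at `y₂`
  set X₁ := ofPoly A * ofPoly dp + ofPoly c * aeval y₂ p + ofPoly B * aeval y₂ r with hX₁
  set X₂ := ofPoly A * ofPoly dr - ofPoly c * aeval y₂ r - ofPoly D * aeval y₂ p with hX₂
  set Z₁ := ofPoly A * ofPoly dp + ofPoly c * aeval y₁ p + ofPoly B * aeval y₁ r with hZ₁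
  set Z₂ := ofPoly A * ofPoly dr - ofPoly c * aeval y₁ r - ofPoly D * aeval y₁ p with hZ₂
  have comp_big : ∀ {y : LaurentAtInf} (hy : y.order = -1) {a b : ℂ[X]} {m : ℤ},
      IsBigOInf (ofPoly a * s - ofPoly b) m →
      IsBigOInf (aeval y a * comp y s - aeval y b) m := by
    intro y hy a b m hab
    have := hab.comp hy
    rwa [map_sub, map_mul, compHom_ofPoly, compHom_ofPoly, compHom_apply] at this
  have aeval_big : ∀ {y : LaurentAtInf} (hy : y.order = -1) {a : ℂ[X]} {m : ℤ},
      IsBigOInf (ofPoly a) m → IsBigOInf (aeval y a) m := by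
    intro y hy a m ha
    have := ha.comp hy
    rwa [compHom_ofPoly] at this
  have s_big : ∀ {y : LaurentAtInf} (hy : y.order = -1), IsBigOInf (comp y s) 0 := by
    intro y hy
    rw [← compHom_apply hy]
    exact hs.comp hy
  have h₁ := h.order_fst
  have h₂ := h.order_snd
  obtain ⟨bΘ, bl⟩ := isBigOInf_cramer (D := ofPoly D) (dp := ofPoly dp) (dr := ofPoly dr)
    h.isBigOInf_sub (isBigOInf_ofPoly hA) (isBigOInf_ofPoly hB) (isBigOInf_ofPoly hc)
    (aeval_big h₁ hp) (aeval_big h₂ hp) (aeval_big h₁ hp') (s_big h₁) (s_big h₂)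
    (Int.natCast_nonneg n) (comp_big h₁ hq) (comp_big h₂ hq) (comp_big h₁ hq')
    (by rw [mul_comm, hdp']) (by rw [mul_comm, hdr']) hric
  obtain ⟨-, bl'⟩ := isBigOInf_cramer (D := ofPoly D) (dp := ofPoly dp) (dr := ofPoly dr)
    h.symm.isBigOInf_sub (isBigOInf_ofPoly hA) (isBigOInf_ofPoly hB) (isBigOInf_ofPoly hc)
    (aeval_big h₂ hp) (aeval_big h₁ hp) (aeval_big h₂ hp') (s_big h₂) (s_big h₁)
    (Int.natCast_nonneg n) (comp_big h₂ hq) (comp_big h₁ hq) (comp_big h₂ hq')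
    (by linear_combination hdp') (by linear_combination hdr') (by linear_combination -hric)
  rw [← hX₁, ← hX₂] at bΘ bl
  rw [← hZ₁, ← hZ₂] at bl'
  have mem_X₁ : (X₁, Z₁) ∈ h.conjPairs := by
    have := add_mem (add_mem (mul_mem (h.ofPoly_mem_conjPairs A) (h.ofPoly_mem_conjPairs dp))
      (mul_mem (h.ofPoly_mem_conjPairs c) (h.swap_aeval_mem_conjPairs p)))
      (mul_mem (h.ofPoly_mem_conjPairs B) (h.swap_aeval_mem_conjPairs r))
    exact this
  have mem_X₂ : (X₂, Z₂) ∈ h.conjPairs := by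
    have := sub_mem (sub_mem (mul_mem (h.ofPoly_mem_conjPairs A) (h.ofPoly_mem_conjPairs dr))
      (mul_mem (h.ofPoly_mem_conjPairs c) (h.swap_aeval_mem_conjPairs r)))
      (mul_mem (h.ofPoly_mem_conjPairs D) (h.swap_aeval_mem_conjPairs p))
    exact this
  have mem_l : (X₁ * aeval y₁ r' - X₂ * aeval y₁ p', Z₁ * aeval y₂ r' - Z₂ * aeval y₂ p')
      ∈ h.conjPairs :=
    sub_mem (mul_mem mem_X₁ (h.aeval_mem_conjPairs r')) (mul_mem mem_X₂ (h.aeval_mem_conjPairs p'))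
  have mem_Θ : (X₂ * aeval y₁ p - X₁ * aeval y₁ r, Z₂ * aeval y₂ p - Z₁ * aeval y₂ r)
      ∈ h.conjPairs :=
    sub_mem (mul_mem mem_X₂ (h.aeval_mem_conjPairs p)) (mul_mem mem_X₁ (h.aeval_mem_conjPairs r))
  have hsymm : Z₂ * aeval y₂ p - Z₁ * aeval y₂ r = X₂ * aeval y₁ p - X₁ * aeval y₁ r := by
    linear_combination ofPoly A * ofPoly dr * hdp' - ofPoly A * ofPoly dp * hdr'
  rw [hsymm] at mem_Θ
  obtain ⟨t, ht⟩ := h.exists_of_diag_mem mem_Θ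
  obtain ⟨m, d, hm, hd⟩ := h.mem_conjPairs.mp mem_l
  rw [ht] at bΘ
  rw [hm] at bl
  rw [hd] at bl'
  have hwF : ofPoly (C w) * ofPoly (C w⁻¹) = 1 := by
    rw [← map_mul, ← Polynomial.C_mul, mul_inv_cancel₀ hw, map_one, map_one]
  have hW₁ : aeval y₁ p * aeval y₁ r' - aeval y₁ r * aeval y₁ p' = ofPoly (C w) := by
    rw [← map_mul, ← map_mul, ← map_sub, hW, aeval_C, ofPoly_C]
  refine ⟨C w⁻¹ * m, -(C w⁻¹ * d), C w⁻¹ * t, ⟨?_, ?_⟩, ?_, ?_, ?_⟩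
  · rw [hdp]
    simp only [map_mul, map_neg]
    linear_combination ofPoly (C w⁻¹) * (aeval y₁ p * hm + aeval y₁ p' * ht - X₁ * hW₁) - X₁ * hwF
  · rw [hdr]
    simp only [map_mul, map_neg]
    linear_combination ofPoly (C w⁻¹) * (aeval y₁ r * hm + aeval y₁ r' * ht - X₂ * hW₁) - X₂ * hwF
  · refine (natDegree_C_mul_le _ _).trans (h.natDegree_le_of_mul (N := N + 1) ?_)
    have := (bl.sub bl').C_mul (1 / 2)
    rw [ofPoly_C, map_div₀, map_one, map_ofNat] at this
    push_cast
    convert this using 1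
    ring
  · rw [natDegree_neg]
    refine (natDegree_C_mul_le _ _).trans ((h.natDegree_le_of_sq_mul (N := N + 1) ?_).trans
      (Nat.le_succ _))
    have := ((bl.add bl').C_mul (1 / 2)).neg
    rw [ofPoly_C, map_div₀, map_one, map_ofNat] at this
    push_cast
    convert this using 1
    ring
  · refine (natDegree_C_mul_le _ _).trans (h.natDegree_le_of_mul (N := N + 1) ?_)
    push_cast
    exact bΘ

/-- The structure relation is linear in the column `(p, r)`, so that together with the Riccati
equation it gives a relation for the function of the second kind `p s - r`. -/
theorem secondKind_of_structureRel (h : QuadraticPair y₁ y₂) {A B c D p' r' p r l π Θ : ℂ[X]}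
    {s : LaurentAtInf} (hrel : StructureRel y₁ y₂ A B c D p' r' p r l π Θ)
    (hric : ofPoly A * (comp y₂ s - comp y₁ s) = (y₂ - y₁) * (ofPoly B * (comp y₁ s * comp y₂ s)
      + ofPoly c * (comp y₁ s + comp y₂ s) + ofPoly D)) :
    ofPoly A * divDiff y₁ y₂ (ofPoly p * s - ofPoly r) =
      (ofPoly l + (y₂ - y₁) * ofPoly π) * comp y₁ (ofPoly p * s - ofPoly r)
        + (ofPoly B * comp y₁ s + ofPoly c) * comp y₂ (ofPoly p * s - ofPoly r)
        + ofPoly Θ * comp y₁ (ofPoly p' * s - ofPoly r') := by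
  have hΔ := h.sub_ne_zero
  have hcomp : ∀ {y : LaurentAtInf} (hy : y.order = -1) (a b : ℂ[X]),
      comp y (ofPoly a * s - ofPoly b) = aeval y a * comp y s - aeval y b := by
    intro y hy a b
    rw [← compHom_apply hy, map_sub, map_mul, compHom_ofPoly, compHom_ofPoly, compHom_apply]
  obtain ⟨h₁, h₂⟩ := hrel
  rw [← mul_div_assoc, div_eq_iff hΔ] at h₁ h₂
  rw [divDiff, hcomp h.order_fst, hcomp h.order_fst, hcomp h.order_snd, ← mul_div_assoc,
    div_eq_iff hΔ]
  linear_combination comp y₁ s * h₁ - h₂ + aeval y₂ p * hric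

end QuadraticPair

/-! ### Recurrences for the coefficients of the structure relations -/

/-- Two consecutive columns of the table of orthogonal and associated polynomials are linearly
independent. -/
theorem eq_zero_of_wronskian {p' r' p r x y w : LaurentAtInf} (hw : w ≠ 0)
    (hW : p * r' - r * p' = w) (hp : x * p + y * p' = 0) (hr : x * r + y * r' = 0) :
    x = 0 ∧ y = 0 := by
  constructor
  · refine (mul_eq_zero.mp ?_).resolve_left hw
    linear_combination r' * hp - p' * hr - x * hW
  · refine (mul_eq_zero.mp ?_).resolve_left hw
    linear_combination p * hr - r * hp - y * hW

namespace QuadraticPair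

variable {y₁ y₂ : LaurentAtInf} {A B c D : ℂ[X]} {p r l π Θ : ℕ → ℂ[X]} {β γ : ℕ → ℂ}

theorem fst_eq {m : ℂ[X]} (hm : y₁ + y₂ = 2 * ofPoly m) :
    y₁ = ofPoly m - (y₂ - y₁) * ofPoly (C (1 / 2)) := by
  rw [ofPoly_C, map_div₀, map_one, map_ofNat]
  linear_combination hm / 2

theorem snd_eq {m : ℂ[X]} (hm : y₁ + y₂ = 2 * ofPoly m) :
    y₂ = ofPoly m + (y₂ - y₁) * ofPoly (C (1 / 2)) := by
  rw [ofPoly_C, map_div₀, map_one, map_ofNat]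
  linear_combination hm / 2

/-- Inserting the recurrence relation into the structure relation of index `n + 2`, by the product
rule for the divided difference, and comparing the coefficients of the two linearly independent
columns of index `n + 1` and `n + 2`. -/
theorem compatibility (h : QuadraticPair y₁ y₂) (hγ : ∀ n, γ n ≠ 0)
    (hp : ∀ n, p (n + 2) = (X - C (β n)) * p (n + 1) - C (γ n) * p n)
    (hr : ∀ n, r (n + 2) = (X - C (β n)) * r (n + 1) - C (γ n) * r n)
    (hW : ∀ n, ∃ w : ℂ, w ≠ 0 ∧ p (n + 1) * r n - r (n + 1) * p n = C w)
    (hrel : ∀ n, StructureRel y₁ y₂ A B c D (p n) (r n) (p (n + 1)) (r (n + 1)) (l n) (π n) (Θ n))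
    (n : ℕ) :
    (y₁ - ofPoly (C (β (n + 1)))) * (ofPoly (l (n + 2)) + (y₂ - y₁) * ofPoly (π (n + 2)))
        + ofPoly (Θ (n + 2))
        - (y₂ - ofPoly (C (β (n + 1)))) * (ofPoly (l (n + 1)) + (y₂ - y₁) * ofPoly (π (n + 1)))
        - ofPoly (C (γ (n + 1))) * (ofPoly (C (1 / γ n)) * ofPoly (Θ n)) - ofPoly A = 0 ∧
    ofPoly (C (γ (n + 1))) * (ofPoly (l n) + (y₂ - y₁) * ofPoly (π n)
        - (ofPoly (l (n + 2)) + (y₂ - y₁) * ofPoly (π (n + 2))))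
        - (y₂ - ofPoly (C (β (n + 1)))) * ofPoly (Θ (n + 1))
        + ofPoly (C (γ (n + 1))) * (ofPoly (C (1 / γ n)) *
          ((y₁ - ofPoly (C (β n))) * ofPoly (Θ n))) = 0 := by
  have hΔ := h.sub_ne_zero
  obtain ⟨w, hw, e⟩ := hW (n + 1)
  have hw' : ofPoly (C w) ≠ 0 := by
    rw [← map_zero ofPoly]
    exact ofPoly_injective.ne (C_ne_zero.mpr hw)
  have hgi : ofPoly (C (γ n)) * ofPoly (C (1 / γ n)) = 1 := by
    rw [← map_mul, ← C_mul, mul_one_div_cancel (hγ n), map_one, map_one]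
  have hpy : ∀ (y : LaurentAtInf) (k : ℕ), aeval y (p (k + 2)) =
      (y - ofPoly (C (β k))) * aeval y (p (k + 1)) - ofPoly (C (γ k)) * aeval y (p k) := by
    intro y k
    rw [hp k]
    simp only [map_sub, map_mul, aeval_X, aeval_C, ofPoly_C]
  have hry : ∀ (y : LaurentAtInf) (k : ℕ), aeval y (r (k + 2)) =
      (y - ofPoly (C (β k))) * aeval y (r (k + 1)) - ofPoly (C (γ k)) * aeval y (r k) := by
    intro y k
    rw [hr k]
    simp only [map_sub, map_mul, aeval_X, aeval_C, ofPoly_C]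
  obtain ⟨p₀, r₀⟩ := hrel n
  obtain ⟨p₁, r₁⟩ := hrel (n + 1)
  obtain ⟨p₂, r₂⟩ := hrel (n + 2)
  rw [← mul_div_assoc, div_eq_iff hΔ] at p₀ r₀ p₁ r₁ p₂ r₂
  simp only [add_assoc, Nat.reduceAdd] at p₁ r₁ p₂ r₂
  have eW : aeval y₁ (p (n + 2)) * aeval y₁ (r (n + 1))
      - aeval y₁ (r (n + 2)) * aeval y₁ (p (n + 1)) = ofPoly (C w) := by
    rw [← map_mul, ← map_mul, ← map_sub, e, aeval_C, ofPoly_C]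
  have hp3 := hpy y₁ (n + 1)
  have hp3' := hpy y₂ (n + 1)
  have hr3 := hry y₁ (n + 1)
  have hr3' := hry y₂ (n + 1)
  simp only [add_assoc, Nat.reduceAdd] at hp3 hp3' hr3 hr3'
  obtain ⟨hx, hy⟩ := eq_zero_of_wronskian hw' eW
    (x := (y₁ - ofPoly (C (β (n + 1)))) * (ofPoly (l (n + 2)) + (y₂ - y₁) * ofPoly (π (n + 2)))
        + ofPoly (Θ (n + 2))
        - (y₂ - ofPoly (C (β (n + 1)))) * (ofPoly (l (n + 1)) + (y₂ - y₁) * ofPoly (π (n + 1)))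
        - ofPoly (C (γ (n + 1))) * (ofPoly (C (1 / γ n)) * ofPoly (Θ n)) - ofPoly A)
    (y := ofPoly (C (γ (n + 1))) * (ofPoly (l n) + (y₂ - y₁) * ofPoly (π n)
        - (ofPoly (l (n + 2)) + (y₂ - y₁) * ofPoly (π (n + 2))))
        - (y₂ - ofPoly (C (β (n + 1)))) * ofPoly (Θ (n + 1))
        + ofPoly (C (γ (n + 1))) * (ofPoly (C (1 / γ n)) *
          ((y₁ - ofPoly (C (β n))) * ofPoly (Θ n))))
    (by
      refine (mul_eq_zero.mp ?_).resolve_left hΔ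
      rw [hp3, hp3', hr3'] at p₂
      linear_combination -p₂ + (y₂ - ofPoly (C (β (n + 1)))) * p₁ - ofPoly (C (γ (n + 1))) * p₀
        - (y₂ - y₁) * ofPoly (C (γ (n + 1))) * ofPoly (C (1 / γ n)) * ofPoly (Θ n) * hpy y₁ n
        + (y₂ - y₁) * ofPoly (C (γ (n + 1))) * ofPoly (Θ n) * aeval y₁ (p n) * hgi)
    (by
      refine (mul_eq_zero.mp ?_).resolve_left hΔ
      rw [hr3, hr3', hp3'] at r₂
      linear_combination -r₂ + (y₂ - ofPoly (C (β (n + 1)))) * r₁ - ofPoly (C (γ (n + 1))) * r₀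
        - (y₂ - y₁) * ofPoly (C (γ (n + 1))) * ofPoly (C (1 / γ n)) * ofPoly (Θ n) * hry y₁ n
        + (y₂ - y₁) * ofPoly (C (γ (n + 1))) * ofPoly (Θ n) * aeval y₁ (r n) * hgi)
  exact ⟨hx, hy⟩

/-- The even and odd parts of the compatibility conditions. -/
theorem compatibility_split (h : QuadraticPair y₁ y₂) (hγ : ∀ n, γ n ≠ 0)
    (hp : ∀ n, p (n + 2) = (X - C (β n)) * p (n + 1) - C (γ n) * p n)
    (hr : ∀ n, r (n + 2) = (X - C (β n)) * r (n + 1) - C (γ n) * r n)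
    (hW : ∀ n, ∃ w : ℂ, w ≠ 0 ∧ p (n + 1) * r n - r (n + 1) * p n = C w)
    (hrel : ∀ n, StructureRel y₁ y₂ A B c D (p n) (r n) (p (n + 1)) (r (n + 1)) (l n) (π n) (Θ n))
    {m δ : ℂ[X]} (hm : y₁ + y₂ = 2 * ofPoly m) (hδ : (y₂ - y₁) ^ 2 = ofPoly δ) (n : ℕ) :
    Θ (n + 2) = A + C (γ (n + 1)) * (C (1 / γ n) * Θ n)
        + C (1 / 2) * δ * (π (n + 2) + π (n + 1)) - (m - C (β (n + 1))) * (l (n + 2) - l (n + 1)) ∧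
    l (n + 2) - l n = (m - C (β n)) * (C (1 / γ n) * Θ n)
        - (m - C (β (n + 1))) * (C (1 / γ (n + 1)) * Θ (n + 1)) ∧
    π (n + 2) - π n = - C (1 / 2) * (C (1 / γ (n + 1)) * Θ (n + 1) + C (1 / γ n) * Θ n) := by
  have h₁ := fst_eq hm
  have h₂ := snd_eq hm
  obtain ⟨ha, hb⟩ := h.compatibility hγ hp hr hW hrel n
  have hgi : C (γ (n + 1)) * C (1 / γ (n + 1)) = 1 := by
    rw [← C_mul, mul_one_div_cancel (hγ (n + 1)), map_one]
  obtain ⟨ha₀, -⟩ := h.eq_zero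
    ((m - C (β (n + 1))) * l (n + 2) - C (1 / 2) * δ * π (n + 2) + Θ (n + 2)
      - (m - C (β (n + 1))) * l (n + 1) - C (1 / 2) * δ * π (n + 1)
      - C (γ (n + 1)) * (C (1 / γ n) * Θ n) - A)
    ((m - C (β (n + 1))) * (π (n + 2) - π (n + 1)) - C (1 / 2) * (l (n + 2) + l (n + 1)))
    (by
      simp only [map_add, map_sub, map_mul, ← hδ]
      linear_combination ha
        - (ofPoly (l (n + 2)) + (y₂ - y₁) * ofPoly (π (n + 2))) * h₁
        + (ofPoly (l (n + 1)) + (y₂ - y₁) * ofPoly (π (n + 1))) * h₂)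
  obtain ⟨hb₀, hb₁⟩ := h.eq_zero
    (C (γ (n + 1)) * (l n - l (n + 2)) - (m - C (β (n + 1))) * Θ (n + 1)
      + C (γ (n + 1)) * (C (1 / γ n) * ((m - C (β n)) * Θ n)))
    (C (γ (n + 1)) * (π n - π (n + 2)) - C (1 / 2) * Θ (n + 1)
      - C (γ (n + 1)) * (C (1 / γ n) * (C (1 / 2) * Θ n)))
    (by
      simp only [map_add, map_sub, map_mul]
      linear_combination hb + ofPoly (Θ (n + 1)) * h₂
        - ofPoly (C (γ (n + 1))) * ofPoly (C (1 / γ n)) * ofPoly (Θ n) * h₁)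
  refine ⟨by linear_combination ha₀, ?_, ?_⟩
  · linear_combination -C (1 / γ (n + 1)) * hb₀
      - (l (n + 2) - l n - (m - C (β n)) * (C (1 / γ n) * Θ n)) * hgi
  · linear_combination -C (1 / γ (n + 1)) * hb₁
      - (π (n + 2) - π n + C (1 / 2) * (C (1 / γ n) * Θ n)) * hgi

/-- The first structure relation determines its coefficients. -/
theorem structureRel_one (h : QuadraticPair y₁ y₂) {b : ℂ} {l π Θ : ℂ[X]}
    (hrel : StructureRel y₁ y₂ A B c D 1 0 (X - C b) 1 l π Θ)
    {m δ : ℂ[X]} (hm : y₁ + y₂ = 2 * ofPoly m) (hδ : (y₂ - y₁) ^ 2 = ofPoly δ) :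
    π = - C (1 / 2) * D ∧ l = - (m - C b) * D - c ∧
      Θ = A - C (1 / 4) * δ * D - (l - c) * (m - C b) + B := by
  have h₁ := fst_eq hm
  have h₂ := snd_eq hm
  have hΔ := h.sub_ne_zero
  have h14 : C (1 / 4 : ℂ) = C (1 / 2) * C (1 / 2) := by
    rw [← C_mul]
    norm_num
  obtain ⟨e₁, e₂⟩ := hrel
  simp only [map_sub, aeval_X, aeval_C, map_one, map_zero, sub_sub_sub_cancel_right, sub_self,
    zero_div, mul_zero, mul_one, add_zero, div_self hΔ, ← ofPoly_C] at e₁ e₂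
  obtain ⟨hl, hπ⟩ := h.eq_zero (l + (m - C b) * D + c) (π + C (1 / 2) * D) (by
    simp only [map_add, map_sub, map_mul]
    linear_combination -e₂ - ofPoly D * h₂)
  obtain ⟨hΘ, -⟩ := h.eq_zero
    (l * (m - C b) - C (1 / 2) * δ * π - c * (m - C b) - B + Θ - A)
    (π * (m - C b) - C (1 / 2) * l - c * C (1 / 2)) (by
    simp only [map_add, map_sub, map_mul, ← hδ]
    linear_combination -e₁ - (ofPoly l + (y₂ - y₁) * ofPoly π) * h₁ + ofPoly c * h₂)
  refine ⟨by linear_combination hπ, by linear_combination hl, ?_⟩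
  rw [h14]
  linear_combination hΘ + C (1 / 2) * δ * hπ

/-- The recurrence relations for the coefficients, in terms of the half-sum `m` and the squared
difference `δ` of the two roots. The one for `l` and the one for `π` come from their second
differences by telescoping. -/
theorem coefficient_recurrences (h : QuadraticPair y₁ y₂) (hγ : ∀ n, γ n ≠ 0) (hγ₀ : γ 0 = 1)
    (hp : ∀ n, p (n + 2) = (X - C (β n)) * p (n + 1) - C (γ n) * p n)
    (hr : ∀ n, r (n + 2) = (X - C (β n)) * r (n + 1) - C (γ n) * r n)
    (hW : ∀ n, ∃ w : ℂ, w ≠ 0 ∧ p (n + 1) * r n - r (n + 1) * p n = C w)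
    (hrel : ∀ n, StructureRel y₁ y₂ A B c D (p n) (r n) (p (n + 1)) (r (n + 1)) (l n) (π n) (Θ n))
    (hπ₀ : π 0 = 0) (hl₀ : l 0 = c) (hΘ₀ : Θ 0 = D)
    (hπ₁ : π 1 = - C (1 / 2) * D) {m δ : ℂ[X]} (hl₁ : l 1 = - (m - C (β 0)) * D - c)
    (hm : y₁ + y₂ = 2 * ofPoly m) (hδ : (y₂ - y₁) ^ 2 = ofPoly δ) (n : ℕ) :
    π (n + 1) + π n = - C (1 / (2 * γ n)) * Θ n
        - ∑ k ∈ Finset.range n, C (1 / γ k) * Θ k ∧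
    l (n + 1) + l n + (m - C (β n)) * (C (1 / γ n) * Θ n) = 0 ∧
    Θ (n + 2) = A + C (1 / 2) * δ * (π (n + 1) + π n)
        + C (1 / γ n) * Θ n
          * (- C (1 / 4) * δ + C (γ (n + 1)) - (m - C (β n)) * (m - C (β (n + 1))))
        + C (1 / γ (n + 1)) * Θ (n + 1) * ((m - C (β (n + 1))) ^ 2 - C (1 / 4) * δ)
        + (m - C (β (n + 1))) * (l (n + 1) - l n) := by
  have hsplit := h.compatibility_split hγ hp hr hW hrel hm hδ
  have h14 : C (1 / 4 : ℂ) = C (1 / 2) * C (1 / 2) := by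
    rw [← C_mul]
    norm_num
  have hhalf : ∀ k, C (1 / (2 * γ k)) = C (1 / 2) * C (1 / γ k) := by
    intro k
    rw [← C_mul]
    congr 1
    rw [one_div_mul_one_div]
  have h2 : C (1 / 2 : ℂ) * 2 = 1 := by
    rw [← map_ofNat C 2, ← C_mul]
    norm_num
  refine ⟨?_, ?_, ?_⟩
  · induction n with
    | zero => simp [hπ₀, hπ₁, hΘ₀, hγ₀]
    | succ n ih =>
      rw [Finset.sum_range_succ, hhalf]
      rw [hhalf] at ih
      linear_combination ih + (hsplit n).2.2 - C (1 / γ n) * Θ n * h2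
  · induction n with
    | zero =>
      rw [hl₀, hl₁, hΘ₀, hγ₀, div_one, map_one]
      ring
    | succ n ih => linear_combination ih + (hsplit n).2.1
  · obtain ⟨e₁, e₂, e₃⟩ := hsplit n
    rw [h14]
    linear_combination e₁ - (m - C (β (n + 1))) * e₂ + C (1 / 2) * δ * e₃

end QuadraticPair

/-! ### Translation to the unshifted indices -/

theorem ofPoly_half (p : ℂ[X]) : ofPoly (Polynomial.C (1 / 2) * p) = ofPoly p / 2 := by
  rw [map_mul, ofPoly_C, map_div₀, map_one, map_ofNat]
  ring

/-- The prescribed values of `l, π, Θ` at the index `-1` are those for which the structure relation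
holds for the initial columns `(0, -1)` and `(1, 0)`. -/
theorem structureRel_zero {y₁ y₂ : LaurentAtInf} {A B c D : ℂ[X]} :
    StructureRel y₁ y₂ A B c D 0 (-1) 1 0 c 0 D := by
  constructor
  · simp
  · simp only [map_neg, map_one, map_zero, sub_self, zero_div]
    ring

theorem structureRelations_iff {y₁ y₂ : LaurentAtInf} (h : QuadraticPair y₁ y₂)
    {A B C D : ℂ[X]} {P P1 l π Θ : ℤ → ℂ[X]} :
    StructureRelations y₁ y₂ A B C D P P1 l π Θ ↔ ∀ n : ℕ, 1 ≤ n →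
      StructureRel y₁ y₂ A B (Polynomial.C (1 / 2) * C) D (shiftP P n) (shiftP1 P1 n)
        (shiftP P (n + 1)) (shiftP1 P1 (n + 1)) (l ((n : ℤ) - 1)) (π ((n : ℤ) - 1))
        (Θ ((n : ℤ) - 1)) := by
  refine forall_congr' fun n => forall_congr' fun hn => ?_
  rw [StructureRel, shiftP_succ, shiftP1_succ, shiftP, shiftP1, if_neg (by omega)]
  simp only [divDiff, comp_ofPoly h.order_fst, comp_ofPoly h.order_snd, ofPoly_half]

theorem Riccati.mul_sub {y₁ y₂ S : LaurentAtInf} (h : QuadraticPair y₁ y₂) {A B C D : ℂ[X]}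
    (hS : Riccati y₁ y₂ S A B C D) :
    ofPoly A * (comp y₂ S - comp y₁ S) = (y₂ - y₁) * (ofPoly B * (comp y₁ S * comp y₂ S)
      + ofPoly (Polynomial.C (1 / 2) * C) * (comp y₁ S + comp y₂ S) + ofPoly D) := by
  rw [Riccati, divDiff, mean, ← mul_div_assoc, div_eq_iff h.sub_ne_zero] at hS
  rw [hS, ofPoly_half]
  ring

section

variable {y₁ y₂ : LaurentAtInf} {u : ℕ → ℂ} {P P1 : ℤ → ℂ[X]} {β γ : ℕ → ℂ} {A B C D : ℂ[X]}

/-- The Riccati equation enters only through the bound on the degrees and the relation for the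
functions of the second kind. -/
theorem exists_structureRelations (h : QuadraticPair y₁ y₂)
    (hP : IsSMOP (stieltjes u) P P1) (hrec : ShiftRec P P1 β γ) (hγ : ∀ n, γ n ≠ 0)
    (hS : Riccati y₁ y₂ (stieltjes u) A B C D) :
    ∃ l π Θ : ℤ → ℂ[X],
      InitialValues C D l π Θ ∧
      StructureRelations y₁ y₂ A B C D P P1 l π Θ ∧
      SecondKindRelations y₁ y₂ (stieltjes u) A B C P P1 l π Θ ∧
      BoundedDegrees l ∧ BoundedDegrees π ∧ BoundedDegrees Θ := by
  have hric := hS.mul_sub h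
  set c := Polynomial.C (1 / 2) * C with hc
  set N := A.natDegree + B.natDegree + c.natDegree + D.natDegree with hN
  -- at the first index the solution is prescribed, afterwards it is given by Cramer's rule
  have hex : ∀ n : ℕ, ∃ l π Θ : ℂ[X],
      StructureRel y₁ y₂ A B c D (shiftP P n) (shiftP1 P1 n) (shiftP P (n + 1))
        (shiftP1 P1 (n + 1)) l π Θ ∧
      l.natDegree ≤ N + 2 ∧ π.natDegree ≤ N + 2 ∧ Θ.natDegree ≤ N + 2 ∧
      (n = 0 → π = 0 ∧ l = c ∧ Θ = D) := by
    intro n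
    rcases n.eq_zero_or_pos with rfl | hn
    · refine ⟨c, 0, D, ?_, by omega, by simp, by omega, fun _ => ⟨rfl, rfl, rfl⟩⟩
      rw [hP.shiftP_zero, shiftP1_zero, hP.shiftP_one, hP.shiftP1_one]
      exact structureRel_zero
    · obtain ⟨w, hw, hW⟩ := hrec.exists_wronskian hγ hP.shiftP_one hP.shiftP1_one n
      have hdeg : ∀ k : ℕ, 1 ≤ k → IsBigOInf (ofPoly (shiftP P k)) (1 - k) := by
        intro k hk
        obtain ⟨j, rfl⟩ := Nat.exists_eq_add_of_le' hk
        rw [shiftP_succ]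
        exact (isBigOInf_ofPoly (hP.natDegree_eq j).le).mono (by push_cast; omega)
      obtain ⟨l, π, Θ, hrel, h1, h2, h3⟩ := h.exists_structureRel (N := N) (D := D) hw hW
        (by omega) (by omega) (by omega) ((hdeg (n + 1) (by omega)).mono (by push_cast; omega))
        (hdeg n hn) ((isBigOInf_stieltjes u).mono (by norm_num))
        (by simpa [shiftQ] using hP.isBigOInf_shiftQ (n + 1)) (hP.isBigOInf_shiftQ n) hric
      exact ⟨l, π, Θ, hrel, h1, h2, h3, by omega⟩
  choose l π Θ hrel hl hπ hΘ h0 using hex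
  have hidx : ∀ n : ℕ, ((n : ℤ) - 1 + 1).toNat = n := fun n => by omega
  refine ⟨fun k => l (k + 1).toNat, fun k => π (k + 1).toNat, fun k => Θ (k + 1).toNat,
    by simpa only [InitialValues, neg_add_cancel, Int.toNat_zero] using h0 0 rfl,
    (structureRelations_iff h).mpr fun n _ => ?_,
    fun n => ?_, ⟨N + 2, fun n _ => hl _⟩, ⟨N + 2, fun n _ => hπ _⟩, ⟨N + 2, fun n _ => hΘ _⟩⟩
  · simp only [hidx]
    exact hrel n
  · have e := hP.secondKind_eq (n + 1)
    rw [Nat.cast_add, Nat.cast_one, add_sub_cancel_right] at e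
    simp only [hidx]
    rw [e, hP.secondKind_eq n, ← ofPoly_half]
    exact h.secondKind_of_structureRel (hrel n) hric

theorem structureRel_of_structureRelations (h : QuadraticPair y₁ y₂)
    (hP : IsSMOP (stieltjes u) P P1) {l π Θ : ℤ → ℂ[X]} (hinit : InitialValues C D l π Θ)
    (hrel : StructureRelations y₁ y₂ A B C D P P1 l π Θ) (n : ℕ) :
    StructureRel y₁ y₂ A B (Polynomial.C (1 / 2) * C) D (shiftP P n) (shiftP1 P1 n)
      (shiftP P (n + 1)) (shiftP1 P1 (n + 1)) (l ((n : ℤ) - 1)) (π ((n : ℤ) - 1))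
      (Θ ((n : ℤ) - 1)) := by
  rcases n.eq_zero_or_pos with rfl | hn
  · obtain ⟨hπ, hl, hΘ⟩ := hinit
    rw [hP.shiftP_zero, shiftP1_zero, hP.shiftP_one, hP.shiftP1_one]
    simp only [Nat.cast_zero, zero_sub, hπ, hl, hΘ]
    exact structureRel_zero
  · exact (structureRelations_iff h).mp hrel n hn

theorem comp_xSub {y : LaurentAtInf} (hy : y.order = -1) (b : ℂ) :
    comp y (xSub b) = y - ofPoly (Polynomial.C b) := by
  rw [xSub, comp_ofPoly hy, map_sub, aeval_X, aeval_C, ofPoly_C]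

theorem mean_xSub (h : QuadraticPair y₁ y₂) {m : ℂ[X]} (hm : y₁ + y₂ = 2 * ofPoly m) (b : ℂ) :
    mean y₁ y₂ (xSub b) = ofPoly (m - Polynomial.C b) := by
  rw [mean, comp_xSub h.order_fst, comp_xSub h.order_snd, map_sub]
  linear_combination hm / 2

theorem comp_xSub_mul (h : QuadraticPair y₁ y₂) {m δ : ℂ[X]} (hm : y₁ + y₂ = 2 * ofPoly m)
    (hδ : (y₂ - y₁) ^ 2 = ofPoly δ) (b : ℂ) :
    comp y₁ (xSub b) * comp y₂ (xSub b) =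
      ofPoly ((m - Polynomial.C b) ^ 2 - Polynomial.C (1 / 4) * δ) := by
  rw [comp_xSub h.order_fst, comp_xSub h.order_snd]
  simp only [map_sub, map_pow, map_mul, ← hδ]
  rw [ofPoly_C (1 / 4), map_div₀, map_one, map_ofNat]
  linear_combination ((y₁ + y₂) / 4 + ofPoly m / 2 - ofPoly (Polynomial.C b)) * hm

end

end LaguerreHahn

theorem mainTheorem3
    (K : LaguerreHahn.Conic) (y₁ y₂ : LaguerreHahn.LaurentAtInf) (hy : K.IsRoots y₁ y₂)
    (u : ℕ → ℂ) (hu : LaguerreHahn.IsRegular u)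
    (P P1 : ℤ → ℂ[X]) (hP : LaguerreHahn.IsSMOP (LaguerreHahn.stieltjes u) P P1)
    (A B C D : ℂ[X])
    (hS : LaguerreHahn.Riccati y₁ y₂ (LaguerreHahn.stieltjes u) A B C D) :
    (∃ β γ : ℕ → ℂ, LaguerreHahn.IsRecurrenceCoeffs P P1 β γ) ∧
    (∃ l π Θ : ℤ → ℂ[X],
      LaguerreHahn.InitialValues C D l π Θ ∧
      LaguerreHahn.StructureRelations y₁ y₂ A B C D P P1 l π Θ ∧
      LaguerreHahn.SecondKindRelations y₁ y₂ (LaguerreHahn.stieltjes u) A B C P P1 l π Θ ∧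
      LaguerreHahn.BoundedDegrees l ∧ LaguerreHahn.BoundedDegrees π ∧
      LaguerreHahn.BoundedDegrees Θ) ∧
    ∀ β γ : ℕ → ℂ, LaguerreHahn.IsRecurrenceCoeffs P P1 β γ →
      ∀ l π Θ : ℤ → ℂ[X], LaguerreHahn.InitialValues C D l π Θ →
        LaguerreHahn.StructureRelations y₁ y₂ A B C D P P1 l π Θ →
        (∀ n : ℕ,
          (π (n + 1) + π n = - Polynomial.C (1 / (2 * γ (n + 1))) * Θ n
            - ∑ k ∈ Finset.range (n + 1), Polynomial.C (1 / γ k) * Θ ((k : ℤ) - 1)) ∧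
          (LaguerreHahn.ofPoly (l (n + 1)) + LaguerreHahn.ofPoly (l n)
            + LaguerreHahn.mean y₁ y₂ (LaguerreHahn.xSub (β (n + 1)))
              * LaguerreHahn.ofPoly (Polynomial.C (1 / γ (n + 1)) * Θ n) = 0) ∧
          (LaguerreHahn.ofPoly A
            + (y₂ - y₁) ^ 2 / 2 * LaguerreHahn.ofPoly (π n + π ((n : ℤ) - 1))
            + LaguerreHahn.ofPoly (Polynomial.C (1 / γ n) * Θ ((n : ℤ) - 1))
              * (- (y₂ - y₁) ^ 2 / 4 + LaguerreHahn.ofPoly (Polynomial.C (γ (n + 1)))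
                - LaguerreHahn.mean y₁ y₂ (LaguerreHahn.xSub (β n))
                  * LaguerreHahn.mean y₁ y₂ (LaguerreHahn.xSub (β (n + 1))))
            + LaguerreHahn.ofPoly (Polynomial.C (1 / γ (n + 1)) * Θ n)
              * (LaguerreHahn.comp y₁ (LaguerreHahn.xSub (β (n + 1)))
                * LaguerreHahn.comp y₂ (LaguerreHahn.xSub (β (n + 1))))
            + LaguerreHahn.mean y₁ y₂ (LaguerreHahn.xSub (β (n + 1)))
              * LaguerreHahn.ofPoly (l n - l ((n : ℤ) - 1))
            = LaguerreHahn.ofPoly (Θ (n + 1)))) ∧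
        π 0 = - Polynomial.C (1 / 2) * D ∧
        LaguerreHahn.ofPoly (l 0) =
          - LaguerreHahn.mean y₁ y₂ (LaguerreHahn.xSub (β 0)) * LaguerreHahn.ofPoly D
            - LaguerreHahn.ofPoly C / 2 ∧
        LaguerreHahn.ofPoly (Θ 0) =
          LaguerreHahn.ofPoly A - (y₂ - y₁) ^ 2 / 4 * LaguerreHahn.ofPoly D
            - (LaguerreHahn.ofPoly (l 0) - LaguerreHahn.ofPoly C / 2)
              * LaguerreHahn.mean y₁ y₂ (LaguerreHahn.xSub (β 0))
            + LaguerreHahn.ofPoly B := by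
  open LaguerreHahn in
  have h := hy.quadraticPair
  obtain ⟨β₀, γ₀, hβγ⟩ := hP.exists_isRecurrenceCoeffs hu
  refine ⟨⟨β₀, γ₀, hβγ⟩,
    exists_structureRelations h hP (hβγ.shiftRec hP hu) hβγ.gamma_ne hS, ?_⟩
  intro β γ hrec l π Θ hinit hrel
  obtain ⟨m, hm⟩ := h.exists_half_sum
  obtain ⟨δ, hδ⟩ := h.exists_disc
  have hshift := hrec.shiftRec hP hu
  have hall := structureRel_of_structureRelations h hP hinit hrel
  have hrel₁ : StructureRel y₁ y₂ A B (Polynomial.C (1 / 2) * C) D 1 0 (X - Polynomial.C (β 0)) 1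
      (l 0) (π 0) (Θ 0) := by
    have hp₂ := (hshift 0).1
    have hr₂ := (hshift 0).2
    simp only [zero_add, hP.shiftP_zero, hP.shiftP_one, hP.shiftP1_one, shiftP1_zero,
      hrec.gamma_zero, map_one, mul_one, mul_zero, sub_zero, zero_sub, mul_neg, neg_neg]
      at hp₂ hr₂
    have h₁ := hall 1
    rw [hp₂, hr₂, hP.shiftP_one, hP.shiftP1_one] at h₁
    simpa using h₁
  obtain ⟨hπ₀, hl₀, hΘ₀⟩ := h.structureRel_one hrel₁ hm hδ
  obtain ⟨iπ, il, iΘ⟩ := hinit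
  have hrecur := h.coefficient_recurrences hrec.gamma_ne hrec.gamma_zero
    (fun n => (hshift n).1) (fun n => (hshift n).2)
    (hshift.exists_wronskian hrec.gamma_ne hP.shiftP_one hP.shiftP1_one) hall
    (by simpa using iπ) (by simpa using il) (by simpa using iΘ) (by simpa using hπ₀)
    (m := m) (δ := δ) (by simpa using hl₀) hm hδ
  have hidx : ∀ n : ℕ, ((n + 1 : ℕ) : ℤ) - 1 = n := fun n => by push_cast; ring
  have hfour : (y₂ - y₁) ^ 2 / 4 = ofPoly (Polynomial.C (1 / 4) * δ) := by
    rw [map_mul, ← hδ, ofPoly_C, map_div₀, map_one, map_ofNat]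
    ring
  have hneg : -(y₂ - y₁) ^ 2 / 4 = -ofPoly (Polynomial.C (1 / 4) * δ) := by
    rw [← hfour]
    ring
  have htwo : (y₂ - y₁) ^ 2 / 2 = ofPoly (Polynomial.C (1 / 2) * δ) := by
    rw [ofPoly_half, hδ]
  refine ⟨fun n => ⟨?_, ?_, ?_⟩, ?_, ?_, ?_⟩
  · have := (hrecur (n + 1)).1
    rw [hidx (n + 1), hidx n, Nat.cast_succ] at this
    rw [this]
  · have := (hrecur (n + 1)).2.1
    rw [hidx (n + 1), hidx n, Nat.cast_succ] at this
    rw [mean_xSub h hm, ← map_mul, ← map_add, ← map_add, this, map_zero]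
  · have := (hrecur n).2.2
    rw [hidx (n + 1), hidx n, Nat.cast_succ] at this
    rw [this, hneg, htwo, mean_xSub h hm, mean_xSub h hm, comp_xSub_mul h hm hδ]
    simp only [map_add, map_sub, map_mul, map_neg]
    ring
  · exact hπ₀
  · rw [hl₀, mean_xSub h hm, ← ofPoly_half]
    simp only [map_sub, map_mul, map_neg]
  · rw [hΘ₀, hfour, mean_xSub h hm, ← ofPoly_half]
    simp only [map_add, map_sub, map_mul]
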